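/- Let $(\mathbb P_{\vartheta,\eta})_{\vartheta\in\Theta,\eta\in\Xi}$ be a family of probability measures on a measurable space, let $H_i\subseteq\Theta$ ($i\in\mathbb N$) be null hypotheses, and let $(P_i)_{i\in\mathbb N}$ be a sequence of $[0,1]$-valued random variables ($p$-values) that are valid, i.e. $\mathbb P_{\vartheta,\eta}(P_i\le t)\le t$ for all $i$, $\vartheta\in H_i$, $\eta\in\Xi$, $t\in[0,1]$ (for instance, uniformly distributed on $[0,1]$ under $H_i$). Assume that for every $(\vartheta,\eta)$ the following holds under $\mathbb P_{\vartheta,\eta}$. Each $P_i$ has an absolutely continuous distribution, with distribution function $F_i$, and the sequence $\tilde P_i=F_i(P_i)$, $i\in\mathbb N$, is exchangeable. There is a random variable $Z$ with distribution function $F_Z$ such that for all $m$ and all $p_1,\dots,p_m$ $$\mathbb P_{\vartheta,\eta}(\tilde P_1\le p_1,\dots,\tilde P_m\le p_m)=\int F_{\tilde P_1\mid Z=z}(p_1)\cdots F_{\tilde P_m\mid Z=z}(p_m)\,dF_Z(z),$$ where the conditional distribution function $F_{\tilde P_i\mid Z=z}$ does not depend on $i$, and (i) $Z\in(0,\infty)$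 with probability $1$; (ii) $F_{\tilde P_i\mid Z=z}(p)=\exp(-z\,\psi^{-1}(p))$ for $p\in(0,1]$ and (almost) all $z\in(0,\infty)$, where $\psi(t)=\mathbb E[\exp(-tZ)]$, $t\ge0$, is the Laplace transform of $Z$. Then: (a) For every $(\vartheta,\eta)$, every $m\ge2$ and all distinct indices $i_1,\dots,i_m$, the distribution of $(P_{i_1},\dots,P_{i_m})$ under $\mathbb P_{\vartheta,\eta}$ is multivariate totally positive of order 2 (MTP$_2$): it has a Lebesgue density $f$ on $\mathbb R^m$ with $f(x)f(y)\le f(x\vee y)f(x\wedge y)$ for all $x,y\in\mathbb R^m$, where $\vee$ and $\wedge$ are the componentwise maximum and minimum. (b) For every $m$ and every $q\in(0,1)$, the linear step-up test $\varphi^{LSU}$ applied to $P_1,\dots,P_m$ controls the false discovery rate (FDR) at level $q$. That is, let $P_{(1)}\le\dots\le P_{(m)}$ be the ordered $p$-values, let $k=\max\{1\le j\le m: P_{(j)}\le jq/m\}$, and let the test reject exactly the $k$ hypotheses that belong to $P_{(1)},\dots,P_{(k)}$ (none if $k$ does not exist). Let $R_m$ be the number of rejected hypotheses among $H_1,\dots,H_m$,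 and $V_m=V_m(\vartheta)$ the number of rejected $H_i$ with $\vartheta\in H_i$. Then $\varphi^{LSU}$ is measurable and $$\mathbb E_{\vartheta,\eta}\Big[\frac{V_m}{\max(R_m,1)}\Big]\le q\qquad\text{for all }\vartheta\in\Theta,\ \eta\in\Xi.$$ -/

import Mathlib

open MeasureTheory ProbabilityTheory Set

noncomputable section

/-! ### Dependence structure -/

/-- The probability integral transforms `F_i(P_i)`, where `F_i` is the cumulative distribution
function of `P_i` under `μ`. -/
def cdfTransform {Ω : Type*} [MeasurableSpace Ω] (μ : Measure Ω) (P : ℕ → Ω → ℝ)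
    (i : ℕ) (ω : Ω) : ℝ :=
  cdf (μ.map (P i)) (P i ω)

/-- An infinite sequence of random variables is exchangeable: for every `n`, the joint law of the
first `n` members is invariant under permutations of them. -/
def Exchangeable {Ω : Type*} [MeasurableSpace Ω] (μ : Measure Ω) (X : ℕ → Ω → ℝ) : Prop :=
  ∀ (n : ℕ) (σ : Equiv.Perm (Fin n)),
    μ.map (fun ω (i : Fin n) => X (σ i) ω) = μ.map (fun ω (i : Fin n) => X i ω)

/-- The mixture representation of the finite-dimensional distributions of a sequence `X`:
`P(X_1 ≤ p_1, …, X_m ≤ p_m) = ∫ F_{X_1 ∣ Z = z}(p_1) ⋯ F_{X_m ∣ Z = z}(p_m) dF_Z(z)` for all `m`.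
Here `ν` is the law of the mixing variable `Z`, and `κ z` is the conditional distribution of a
single member of the sequence given `Z = z`. -/
def IsMixture {Ω : Type*} [MeasurableSpace Ω] (μ : Measure Ω) (X : ℕ → Ω → ℝ)
    (ν : Measure ℝ) (κ : Kernel ℝ ℝ) : Prop :=
  ∀ (m : ℕ) (p : Fin m → ℝ),
    μ {ω | ∀ i : Fin m, X i ω ≤ p i} = ∫⁻ z, ∏ i : Fin m, κ z (Iic (p i)) ∂ν

/-- The Laplace transform `ψ(t) = E[exp(-tZ)]` of a law `ν` of `Z`. -/
def laplace (ν : Measure ℝ) (t : ℝ) : ℝ :=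
  ∫ z, Real.exp (-(t * z)) ∂ν

/-- The (generalized) inverse on `(0, 1]` of a nonincreasing function `ψ` on `[0, ∞)`. -/
def generatorInv (ψ : ℝ → ℝ) (p : ℝ) : ℝ :=
  sInf {t : ℝ | 0 ≤ t ∧ ψ t ≤ p}

/-- A law on `ℝ^m` is multivariate totally positive of order 2: it has a Lebesgue density `f` with
`f(x) f(y) ≤ f(x ∨ y) f(x ∧ y)` for all `x`, `y`, where `∨`, `∧` are the componentwise maximum and
minimum. -/
def IsMTP2 {m : ℕ} (μ : Measure (Fin m → ℝ)) : Prop :=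
  ∃ f : (Fin m → ℝ) → NNReal, Measurable f ∧
    μ = volume.withDensity (fun x => (f x : ENNReal)) ∧
    ∀ x y, f x * f y ≤ f (x ⊔ y) * f (x ⊓ y)

/-! ### Multiple tests -/

/-- The order statistics `p_(1) ≤ … ≤ p_(m)`; the index `j` stands for `j + 1`. -/
def orderStat {m : ℕ} (p : Fin m → ℝ) (j : Fin m) : ℝ :=
  p (Tuple.sort p j)

/-- `k = max {1 ≤ j ≤ m : p_(j) ≤ j q / m}`, and `k = 0` if there is no such `j`. -/
def lsuCount {m : ℕ} (q : ℝ) (p : Fin m → ℝ) : ℕ :=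
  (Finset.univ.filter (fun j : Fin m => orderStat p j ≤ ((j : ℝ) + 1) * q / m)).sup
    (fun j => (j : ℕ) + 1)

/-- The linear step-up test: exactly the hypotheses belonging to `p_(1), …, p_(k)` are rejected
(`true` means rejection; `(Tuple.sort p).symm i` is the zero-based rank of `p_i`). -/
def linearStepUp (m : ℕ) (q : ℝ) (p : Fin m → ℝ) (i : Fin m) : Bool :=
  decide (((Tuple.sort p).symm i : ℕ) < lsuCount q p)

/-- The number of rejections of `φ` at `p`. -/
def numRejections {m : ℕ} (φ : (Fin m → ℝ) → Fin m → Bool) (p : Fin m → ℝ) : ℕ :=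
  (Finset.univ.filter (fun i => φ p i = true)).card

open scoped Classical in
/-- The number of rejections of `φ` at `p` among the indices in `I₀`. -/
def numFalseRejections {m : ℕ} (I₀ : Set (Fin m)) (φ : (Fin m → ℝ) → Fin m → Bool)
    (p : Fin m → ℝ) : ℕ :=
  (Finset.univ.filter (fun i => i ∈ I₀ ∧ φ p i = true)).card

/-- The false discovery rate `E[V / max(R, 1)]` of `φ`, applied to the random vector `X` under `μ`,
when `I₀` is the set of indices of the true null hypotheses. -/
def falseDiscoveryRate {Ω : Type*} [MeasurableSpace Ω] {m : ℕ} (μ : Measure Ω)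
    (X : Ω → Fin m → ℝ) (I₀ : Set (Fin m)) (φ : (Fin m → ℝ) → Fin m → Bool) : ℝ :=
  ∫ ω, (numFalseRejections I₀ φ (X ω) : ℝ) / (max (numRejections φ (X ω)) 1 : ℕ) ∂μ

/-- In the statistical model `(Pr ϑ η)`, with null hypotheses `H i ⊆ Θ`, the multiple test `φ`
(a measurable map) applied to the first `m` of the p-values `P` controls the false discovery rate
at level `q`. -/
def ControlsFDR {Ω Θ Ξ : Type*} [MeasurableSpace Ω] (Pr : Θ → Ξ → Measure Ω) (H : ℕ → Set Θ)
    (P : ℕ → Ω → ℝ) {m : ℕ} (φ : (Fin m → ℝ) → Fin m → Bool) (q : ℝ) : Prop :=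
  Measurable φ ∧
    ∀ ϑ η, falseDiscoveryRate (Pr ϑ η) (fun ω (i : Fin m) => P i ω) {i | ϑ ∈ H i} φ ≤ q

end

open scoped ENNReal NNReal Topology
open Filter

/-! ### Chebyshev's integral inequality -/

/-! Put `T_j = ψ⁻¹(F_j(P_j))`. Hypothesis (ii) says that, given `Z = z`, the times `T_j` are
independent exponential variables with rate `z`, and `P_j` is a nonincreasing function of `T_j`.
Both claims then reduce to Chebyshev's integral inequality
(`lintegral_mul_lintegral_le_of_monotoneOn`), applied to an exponential tilt of the law `ν` of `Z`.

For (a), write `M_k(s) = ∫ z^k exp(-zs) dν(z)`. The times have joint density `M_m(∑ t_j)`, and each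
has density `M_1`, so the change of variables gives `P` the density `∏ f_j(x_j) / M_1(T_j(x_j)) ·
M_m(∑ T_j(x_j))`, with `T_j(x) = ψ⁻¹(F_j(x))` (`map_eq_withDensity_jointDensity`). Passing to `x ∨
y` and `x ∧ y` only regroups the univariate factors and preserves the total of the two time sums;
what remains is the log-convexity of `M_m` (`laplaceMoment_mul_le`).

Part (b) does not go through the density. The vector `T` is realized as `E_j / Z` with independent
standard exponentials `E_j` (`map_eq_map_timeToP`). Conditioning on `P_i ≤ s` means conditioning on
`T_i ≥ τ`; by lack of memory this adds `τ` to the `i`-th time and tilts the law of `Z` by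
`exp(-zτ)`. Raising `s` lowers `τ`, which shortens the time and favours large `Z`; both push the
p-values up. Hence the conditional probability of an upper set given `P_i ≤ s` is nondecreasing in
`s` (`measure_mem_and_le_mul_le`). Applied to the upper sets `{R ≤ k}`, this makes the
Benjamini-Yekutieli sum telescope (`sum_div_le_of_positive_dependence`), so each true null
contributes at most `q / m`. -/

/-- The rearrangement inequality for two pairs of extended nonnegative numbers. -/
theorem ENNReal.mul_add_mul_le_of_le {a b c d : ℝ≥0∞} (hab : a ≤ b) (hcd : c ≤ d) :
    a * d + b * c ≤ a * c + b * d := by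
  obtain ⟨u, rfl⟩ := exists_add_of_le hab
  obtain ⟨v, rfl⟩ := exists_add_of_le hcd
  have : a * c + (a + u) * (c + v) = a * (c + v) + (a + u) * c + u * v := by ring
  rw [this]
  exact le_self_add

/-- Chebyshev's integral inequality for two functions that are nondecreasing on a set of full
measure. -/
theorem lintegral_mul_lintegral_le_of_monotoneOn {α : Type*} [MeasurableSpace α] [LinearOrder α]
    {μ : Measure α} {s : Set α} (hs : ∀ᵐ x ∂μ, x ∈ s) {f g : α → ℝ≥0∞} (hf : Measurable f)
    (hg : Measurable g) (hfs : MonotoneOn f s) (hgs : MonotoneOn g s) :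
    (∫⁻ x, f x ∂μ) * ∫⁻ x, g x ∂μ ≤ μ univ * ∫⁻ x, f x * g x ∂μ := by
  -- Symmetrization: this is the double integral of `(f x - f y)(g x - g y) ≥ 0`, arranged without
  -- subtraction. Each side is twice the corresponding side of the claim.
  have key : ∫⁻ x, ∫⁻ y, (f x * g y + f y * g x) ∂μ ∂μ
      ≤ ∫⁻ x, ∫⁻ y, (f x * g x + f y * g y) ∂μ ∂μ := by
    refine lintegral_mono_ae (hs.mono fun x hx => lintegral_mono_ae (hs.mono fun y hy => ?_))
    rcases le_total x y with h | h
    · exact ENNReal.mul_add_mul_le_of_le (hfs hx hy h) (hgs hx hy h)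
    · have := ENNReal.mul_add_mul_le_of_le (hfs hy hx h) (hgs hy hx h)
      rw [add_comm (f x * g y), add_comm (f x * g x)]
      exact this
  have h1 : ∀ x, ∫⁻ y, (f x * g y + f y * g x) ∂μ
      = f x * (∫⁻ y, g y ∂μ) + (∫⁻ y, f y ∂μ) * g x := fun x => by
    rw [lintegral_add_left (hg.const_mul _), lintegral_const_mul _ hg, lintegral_mul_const _ hf]
  have h2 : ∀ x, ∫⁻ y, (f x * g x + f y * g y) ∂μ
      = f x * g x * μ univ + ∫⁻ y, f y * g y ∂μ := fun x => by
    rw [lintegral_add_left measurable_const, lintegral_const]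
  have hfg : Measurable fun x => f x * g x := hf.mul hg
  simp only [h1, h2] at key
  rw [lintegral_add_left (hf.mul_const _), lintegral_mul_const _ hf, lintegral_const_mul _ hg,
    lintegral_add_left (hfg.mul_const _), lintegral_mul_const _ hfg,
    lintegral_const, mul_comm (lintegral _ _) (μ univ),
    ← two_mul, ← two_mul] at key
  exact (ENNReal.mul_le_mul_iff_right two_ne_zero ENNReal.ofNat_ne_top).1 key

/-! ### Measures on finite-dimensional space -/

/-- A finite measure on `ℝ^m` is determined by its multivariate distribution function. -/
theorem MeasureTheory.Measure.pi_ext_of_Iic {m : ℕ} (μ ν : Measure (Fin m → ℝ))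
    [IsFiniteMeasure μ] (h : ∀ x, μ (Iic x) = ν (Iic x)) : μ = ν := by
  have hsp : IsCountablySpanning (range (Iic : ℝ → Set ℝ)) :=
    ⟨fun n : ℕ => Iic (n : ℝ), fun n => mem_range_self _, by
      ext x; simpa using exists_nat_ge x⟩
  have hgen : MeasurableSpace.generateFrom (Set.pi univ '' Set.pi univ
      fun _ : Fin m => range (Iic : ℝ → Set ℝ)) = MeasurableSpace.pi :=
    generateFrom_eq_pi (fun _ => by
      rw [← borel_eq_generateFrom_Iic, BorelSpace.measurable_eq (α := ℝ)]) (fun _ => hsp)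
  have hform : ∀ s ∈ Set.pi univ '' Set.pi univ fun _ : Fin m => range (Iic : ℝ → Set ℝ),
      ∃ x, s = Iic x := by
    rintro _ ⟨t, ht, rfl⟩
    choose x hx using fun j => ht j (mem_univ j)
    refine ⟨x, ?_⟩
    rw [← pi_univ_Iic]
    exact congrArg _ (funext fun j => (hx j).symm)
  refine Measure.ext_of_generateFrom_of_iUnion _ (fun n : ℕ => Iic (fun _ : Fin m => (n : ℝ)))
    hgen.symm ?_ ?_ ?_ (fun n => measure_ne_top _ _) ?_
  · exact IsPiSystem.pi fun _ => by simpa using isPiSystem_image_Iic (univ : Set ℝ)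
  · ext x
    simp only [mem_iUnion, mem_Iic, mem_univ, iff_true, Pi.le_def]
    obtain ⟨n, hn⟩ := exists_nat_ge (∑ j, |x j|)
    exact ⟨n, fun j => (le_abs_self _).trans ((Finset.single_le_sum (f := fun j => |x j|)
      (fun _ _ => abs_nonneg _) (Finset.mem_univ j)).trans hn)⟩
  · exact fun n => ⟨fun _ => Iic (n : ℝ), fun _ _ => mem_range_self _, by rw [pi_univ_Iic]⟩
  · intro s hs
    obtain ⟨x, rfl⟩ := hform s hs
    exact h x

/-- Tonelli's theorem for products of functions of one variable each. -/
theorem lintegral_pi_prod {m : ℕ} (μ : Fin m → Measure ℝ) [∀ j, SigmaFinite (μ j)]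
    {f : Fin m → ℝ → ℝ≥0∞} (hf : ∀ j, Measurable (f j)) :
    ∫⁻ x, ∏ j, f j (x j) ∂(Measure.pi μ) = ∏ j, ∫⁻ y, f j y ∂(μ j) := by
  induction m with
  | zero => simp
  | succ m ih =>
    have hmp := (measurePreserving_piFinSuccAbove μ 0).symm
    rw [← hmp.lintegral_comp_emb (MeasurableEquiv.measurableEmbedding _)]
    have hm : Measurable fun y : Fin m → ℝ => ∏ j : Fin m, f j.succ (y j) :=
      Finset.measurable_prod _ fun j _ => (hf _).comp (measurable_pi_apply j)
    simp only [Fin.prod_univ_succ, MeasurableEquiv.piFinSuccAbove_symm_apply,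
      Fin.insertNthEquiv_zero, Fin.consEquiv_apply, Fin.cons_zero, Fin.cons_succ]
    rw [lintegral_prod_mul (hf 0).aemeasurable hm.aemeasurable]
    congr 1
    exact ih (fun j => μ j.succ) fun j => hf _

/-- The product formula on boxes. -/
theorem setLIntegral_pi_prod {m : ℕ} (s : Fin m → Set ℝ)
    {f : Fin m → ℝ → ℝ≥0∞} (hf : ∀ j, Measurable (f j)) :
    ∫⁻ x in Set.pi univ s, ∏ j, f j (x j) = ∏ j, ∫⁻ y in s j, f j y := by
  rw [volume_pi, Measure.restrict_pi_pi, lintegral_pi_prod _ hf]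

/-! ### Exponential distributions -/

/-- The tail of the exponential distribution with rate `z`. -/
theorem lintegral_Ioi_exp {z : ℝ} (hz : 0 < z) (a : ℝ) :
    ∫⁻ t in Ioi a, ENNReal.ofReal (z * Real.exp (-(z * t)))
      = ENNReal.ofReal (Real.exp (-(z * a))) := by
  have hint : IntegrableOn (fun t => z * Real.exp (-(z * t))) (Ioi a) := by
    simp only [neg_mul_eq_neg_mul]
    exact (exp_neg_integrableOn_Ioi a hz).const_mul z
  rw [← ofReal_integral_eq_lintegral_ofReal hint
    (Eventually.of_forall fun t => by positivity)]
  congr 1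
  have := integral_Ioi_of_hasDerivAt_of_tendsto' (a := a) (f := fun t => -Real.exp (-(z * t)))
    (m := 0) (fun t _ => hasDerivAt_neg_exp_mul_exp) hint (by
      rw [← neg_zero]
      refine (Real.tendsto_exp_atBot.comp ?_).neg
      exact tendsto_neg_atTop_atBot.comp (tendsto_id.const_mul_atTop hz))
  rw [this]; ring

/-! ### The Laplace transform of a positive random variable and its inverse -/

section Laplace

variable {ν : Measure ℝ} [IsProbabilityMeasure ν]

theorem measurable_laplace : Measurable (laplace ν) := by
  have : StronglyMeasurable fun x : ℝ × ℝ => Real.exp (-(x.1 * x.2)) :=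
    (by fun_prop : Measurable fun x : ℝ × ℝ => Real.exp (-(x.1 * x.2))).stronglyMeasurable
  exact this.integral_prod_right'.measurable

theorem integrable_exp_neg_mul (hν : ∀ᵐ z ∂ν, 0 < z) {t : ℝ} (ht : 0 ≤ t) :
    Integrable (fun z => Real.exp (-(t * z))) ν := by
  refine Integrable.of_bound (C := 1) (by fun_prop) (hν.mono fun z hz => ?_)
  rw [Real.norm_eq_abs, Real.abs_exp, Real.exp_le_one_iff, neg_nonpos]
  positivity

theorem ofReal_laplace (hν : ∀ᵐ z ∂ν, 0 < z) {t : ℝ} (ht : 0 ≤ t) :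
    ENNReal.ofReal (laplace ν t) = ∫⁻ z, ENNReal.ofReal (Real.exp (-(z * t))) ∂ν := by
  rw [laplace, ofReal_integral_eq_lintegral_ofReal (integrable_exp_neg_mul hν ht)
    (Eventually.of_forall fun z => by positivity)]
  simp only [mul_comm t]

theorem laplace_zero : laplace ν 0 = 1 := by simp [laplace]

theorem laplace_strictAntiOn (hν : ∀ᵐ z ∂ν, 0 < z) : StrictAntiOn (laplace ν) (Ici 0) := by
  intro s hs t ht hst
  rw [← sub_pos, laplace, laplace,
    ← integral_sub (integrable_exp_neg_mul hν hs) (integrable_exp_neg_mul hν ht)]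
  have hpos : ∀ᵐ z ∂ν, 0 < Real.exp (-(s * z)) - Real.exp (-(t * z)) := hν.mono fun z hz => by
    rw [sub_pos, Real.exp_lt_exp]; nlinarith
  rw [integral_pos_iff_support_of_nonneg_ae (hpos.mono fun z hz => hz.le)
    ((integrable_exp_neg_mul hν hs).sub (integrable_exp_neg_mul hν ht))]
  have : Function.support (fun z => Real.exp (-(s * z)) - Real.exp (-(t * z))) =ᵐ[ν] univ :=
    eventuallyEq_univ.2 (hpos.mono fun z hz => hz.ne')
  rw [measure_congr this]
  simp

theorem laplace_pos (hν : ∀ᵐ z ∂ν, 0 < z) {t : ℝ} (ht : 0 ≤ t) : 0 < laplace ν t :=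
  lt_of_le_of_lt (integral_nonneg fun z => (Real.exp_pos _).le)
    (laplace_strictAntiOn hν ht (by simp only [mem_Ici]; linarith) (lt_add_one t))

theorem laplace_mem_Ioo (hν : ∀ᵐ z ∂ν, 0 < z) {t : ℝ} (ht : 0 < t) :
    laplace ν t ∈ Ioo (0 : ℝ) 1 :=
  ⟨laplace_pos hν ht.le,
    laplace_zero (ν := ν) ▸ laplace_strictAntiOn hν (mem_Ici.2 le_rfl) ht.le ht⟩

theorem continuousOn_laplace (hν : ∀ᵐ z ∂ν, 0 < z) : ContinuousOn (laplace ν) (Ici 0) := by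
  refine continuousOn_of_dominated (bound := fun _ => 1) (fun t _ => by fun_prop)
    (fun t ht => hν.mono fun z hz => ?_) (integrable_const _)
    (Eventually.of_forall fun z => by fun_prop)
  rw [Real.norm_eq_abs, Real.abs_exp, Real.exp_le_one_iff, neg_nonpos]
  exact mul_nonneg ht hz.le

theorem tendsto_laplace_atTop (hν : ∀ᵐ z ∂ν, 0 < z) : Tendsto (laplace ν) atTop (𝓝 0) := by
  have h := tendsto_integral_filter_of_dominated_convergence (μ := ν) (l := atTop)
    (F := fun t z : ℝ => Real.exp (-(t * z))) (f := fun _ => 0) (fun _ => 1)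
    (Eventually.of_forall fun t => by fun_prop)
    ((eventually_ge_atTop 0).mono fun t ht => hν.mono fun z hz => by
      rw [Real.norm_eq_abs, Real.abs_exp, Real.exp_le_one_iff, neg_nonpos]
      positivity) (integrable_const _)
    (hν.mono fun z hz => Real.tendsto_exp_atBot.comp
      (tendsto_neg_atTop_atBot.comp (tendsto_id.atTop_mul_const hz)))
  rw [integral_zero] at h
  exact h

theorem generatorInv_nonneg (ψ : ℝ → ℝ) (p : ℝ) : 0 ≤ generatorInv ψ p :=
  Real.sInf_nonneg fun _ h => h.1

theorem generatorInv_mem (hν : ∀ᵐ z ∂ν, 0 < z) {p : ℝ} (hp : 0 < p) :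
    laplace ν (generatorInv (laplace ν) p) ≤ p := by
  have hcl : IsClosed {t : ℝ | 0 ≤ t ∧ laplace ν t ≤ p} :=
    (continuousOn_laplace hν).preimage_isClosed_of_isClosed isClosed_Ici isClosed_Iic
  have hne : {t : ℝ | 0 ≤ t ∧ laplace ν t ≤ p}.Nonempty := by
    obtain ⟨t, ht, ht0⟩ := (((tendsto_laplace_atTop hν).eventually_le_const hp).and
      (eventually_ge_atTop 0)).exists
    exact ⟨t, ht0, ht⟩
  exact (hcl.csInf_mem hne ⟨0, fun t ht => ht.1⟩).2

/-- The Galois connection between `ψ` and its inverse: continuity makes the infimum attained, and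
monotonicity does the rest. It holds for `p > 1` too, where the inverse is `0`. -/
theorem generatorInv_le_iff (hν : ∀ᵐ z ∂ν, 0 < z) {p t : ℝ} (hp : 0 < p) (ht : 0 ≤ t) :
    generatorInv (laplace ν) p ≤ t ↔ laplace ν t ≤ p :=
  ⟨fun h => ((laplace_strictAntiOn hν).antitoneOn (generatorInv_nonneg _ p) ht h).trans
    (generatorInv_mem hν hp), fun h => csInf_le ⟨0, fun _ hs => hs.1⟩ ⟨ht, h⟩⟩

theorem generatorInv_laplace (hν : ∀ᵐ z ∂ν, 0 < z) {t : ℝ} (ht : 0 ≤ t) :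
    generatorInv (laplace ν) (laplace ν t) = t := by
  have h := generatorInv_le_iff hν (laplace_pos hν ht) ht
  refine le_antisymm (h.2 le_rfl) ?_
  exact ((laplace_strictAntiOn hν).le_iff_ge (generatorInv_nonneg _ _) ht).1
    (generatorInv_mem hν (laplace_pos hν ht))

theorem laplace_generatorInv (hν : ∀ᵐ z ∂ν, 0 < z) {p : ℝ} (hp : p ∈ Ioc (0 : ℝ) 1) :
    laplace ν (generatorInv (laplace ν) p) = p := by
  obtain ⟨T, hT, hT0⟩ := (((tendsto_laplace_atTop hν).eventually_le_const hp.1).and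
      (eventually_ge_atTop 0)).exists
  obtain ⟨t, ht, rfl⟩ := intermediate_value_Icc' hT0
    ((continuousOn_laplace hν).mono fun x hx => hx.1) ⟨hT, laplace_zero (ν := ν) ▸ hp.2⟩
  rw [generatorInv_laplace hν ht.1]

theorem generatorInv_antitoneOn (hν : ∀ᵐ z ∂ν, 0 < z) :
    AntitoneOn (generatorInv (laplace ν)) (Ioi 0) := fun _ hp _ hq hpq =>
  (generatorInv_le_iff hν hq (generatorInv_nonneg _ _)).2 ((generatorInv_mem hν hp).trans hpq)

theorem generatorInv_pos (hν : ∀ᵐ z ∂ν, 0 < z) {p : ℝ} (hp : p ∈ Ioo (0 : ℝ) 1) :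
    0 < generatorInv (laplace ν) p := by
  refine (generatorInv_nonneg _ _).lt_of_ne fun h => ?_
  have := laplace_generatorInv hν ⟨hp.1, hp.2.le⟩
  rw [← h, laplace_zero] at this
  exact hp.2.ne this.symm

theorem measurable_generatorInv (hν : ∀ᵐ z ∂ν, 0 < z) :
    Measurable (generatorInv (laplace ν)) := by
  refine measurable_of_Iic fun t => ?_
  rcases lt_or_ge t 0 with ht | ht
  · convert MeasurableSet.empty
    ext p
    simpa using ht.trans_le (generatorInv_nonneg _ p)
  · convert (measurableSet_Iic (a := (0 : ℝ))).union (measurableSet_Ici (a := laplace ν t))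
    ext p
    simp only [mem_preimage, mem_Iic, mem_union, mem_Ici]
    rcases le_or_gt p 0 with hp | hp
    -- As `ψ > 0`, the infimum is over the empty set for `p ≤ 0` and takes the default value `0`.
    · have : {t : ℝ | 0 ≤ t ∧ laplace ν t ≤ p} = ∅ :=
        eq_empty_of_forall_notMem fun s hs => (hs.2.trans hp).not_gt (laplace_pos hν hs.1)
      simp [generatorInv, this, ht, hp]
    · rw [generatorInv_le_iff hν hp ht]
      simp [hp]

end Laplace

/-! ### Finite-dimensional distributions -/

/-- The finite-dimensional distributions of the sequence `U` on `(0, 1]^m` are given by the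
Archimedean copula with generator `laplace ν`, written as a mixture over `ν`. -/
def IsArchimedeanMixture {Ω : Type*} [MeasurableSpace Ω] (μ : Measure Ω) (U : ℕ → Ω → ℝ)
    (ν : Measure ℝ) : Prop :=
  ∀ (m : ℕ) (idx : Fin m → ℕ), Function.Injective idx → ∀ p : Fin m → ℝ,
    (∀ j, p j ∈ Ioc (0 : ℝ) 1) → μ {ω | ∀ j, U (idx j) ω ≤ p j} =
      ∫⁻ z, ∏ j, ENNReal.ofReal (Real.exp (-(z * generatorInv (laplace ν) (p j)))) ∂ν

/-- Indices outside the chosen ones get the threshold `1`, where a distribution function on `[0, 1]`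
contributes the factor `1`. This passes from initial segments to arbitrary distinct indices. -/
theorem prod_fin_extend_one {m n : ℕ} {idx : Fin m → ℕ} (hidx : Function.Injective idx)
    (hn : ∀ j, idx j < n) (p : Fin m → ℝ) {F : ℝ → ℝ≥0∞} (hF : F 1 = 1) :
    ∏ i : Fin n, F (Function.extend idx p 1 i) = ∏ j, F (p j) := by
  rw [← Finset.prod_range fun i => F (Function.extend idx p 1 i),
    ← Finset.prod_subset (s₁ := Finset.univ.image idx), Finset.prod_image hidx.injOn]
  · simp [hidx.extend_apply]
  · intro i hi
    obtain ⟨j, -, rfl⟩ := Finset.mem_image.1 hi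
    exact Finset.mem_range.2 (hn j)
  · intro i _ hi
    rw [Function.extend_apply' _ _ _ (by simpa using hi), Pi.one_apply, hF]

section Law

variable {Ω : Type*} [MeasurableSpace Ω] {μ : Measure Ω}
  {P : ℕ → Ω → ℝ} {ν : Measure ℝ} [IsProbabilityMeasure ν]

theorem IsMixture.isArchimedeanMixture {U : ℕ → Ω → ℝ} {κ : Kernel ℝ ℝ}
    (hU : ∀ i ω, U i ω ≤ 1) (hν : ∀ᵐ z ∂ν, 0 < z) (hmix : IsMixture μ U ν κ)
    (hcond : ∀ᵐ z ∂ν, ∀ p ∈ Ioc (0 : ℝ) 1,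
      κ z (Iic p) = ENNReal.ofReal (Real.exp (-(z * generatorInv (laplace ν) p)))) :
    IsArchimedeanMixture μ U ν := by
  intro m idx hidx p hp
  set n := Finset.univ.sup idx + 1 with hn
  have hlt : ∀ j, idx j < n := fun j => Nat.lt_succ_of_le (Finset.le_sup (Finset.mem_univ j))
  have hset : {ω | ∀ j, U (idx j) ω ≤ p j} =
      {ω | ∀ i : Fin n, U i ω ≤ Function.extend idx p 1 i} := by
    ext ω
    refine ⟨fun h i => ?_, fun h j => ?_⟩
    · by_cases hi : ∃ j, idx j = i
      · obtain ⟨j, hj⟩ := hi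
        rw [← hj, hidx.extend_apply]
        exact h j
      · rw [Function.extend_apply' _ _ _ hi]
        exact hU _ _
    · simpa [hidx.extend_apply] using h ⟨idx j, hlt j⟩
  rw [hset, hmix n fun i => Function.extend idx p 1 i]
  refine lintegral_congr_ae (hcond.mono fun z hz => ?_)
  have h1 : κ z (Iic 1) = 1 := by
    have h0 : generatorInv (laplace ν) 1 = 0 := by
      simpa [laplace_zero] using generatorInv_laplace hν (le_refl (0 : ℝ))
    rw [hz 1 ⟨one_pos, le_rfl⟩, h0]
    simp
  dsimp only
  rw [prod_fin_extend_one hidx hlt p (F := fun x => κ z (Iic x)) h1]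
  exact Finset.prod_congr rfl fun j _ => hz _ (hp j)

theorem IsArchimedeanMixture.measure_le {U : ℕ → Ω → ℝ} (hν : ∀ᵐ z ∂ν, 0 < z)
    (h : IsArchimedeanMixture μ U ν) (i : ℕ) {v : ℝ} (hv : v ∈ Icc (0 : ℝ) 1) :
    μ {ω | U i ω ≤ v} = ENNReal.ofReal v := by
  have hpos : ∀ v ∈ Ioc (0 : ℝ) 1, μ {ω | U i ω ≤ v} = ENNReal.ofReal v := fun v hv => by
    have := h 1 (fun _ => i) (Function.injective_of_subsingleton _) (fun _ => v) (fun _ => hv)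
    simp only [forall_const, Finset.univ_unique, Finset.prod_singleton] at this
    rw [this, ← ofReal_laplace hν (generatorInv_nonneg _ _), laplace_generatorInv hν hv]
  rcases hv.1.eq_or_lt with rfl | h0
  -- The mixture formula covers only positive thresholds, so an atom at `0` is excluded by squeezing
  -- with small positive ones.
  · rw [ENNReal.ofReal_zero, ← nonpos_iff_eq_zero]
    refine ENNReal.le_of_forall_pos_le_add fun ε hε _ => ?_
    rw [zero_add]
    have hm : min (ε : ℝ) 1 ∈ Ioc (0 : ℝ) 1 := ⟨lt_min hε one_pos, min_le_right _ _⟩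
    calc μ {ω | U i ω ≤ 0} ≤ μ {ω | U i ω ≤ min (ε : ℝ) 1} :=
          measure_mono fun ω hω => le_trans hω hm.1.le
      _ = ENNReal.ofReal (min (ε : ℝ) 1) := hpos _ hm
      _ ≤ ε := by
          rw [← ENNReal.ofReal_coe_nnreal]
          exact ENNReal.ofReal_le_ofReal (min_le_left _ _)
  · exact hpos v ⟨h0, hv.2⟩

theorem measurable_cdfTransform (hmeas : ∀ i, Measurable (P i)) (i : ℕ) :
    Measurable (cdfTransform μ P i) :=
  (monotone_cdf _).measurable.comp (hmeas i)

theorem cdfTransform_mem_Icc (i : ℕ) (ω : Ω) : cdfTransform μ P i ω ∈ Icc (0 : ℝ) 1 :=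
  ⟨cdf_nonneg _ _, cdf_le_one _ _⟩

variable [IsProbabilityMeasure μ]

theorem ofReal_cdf_map (hmeas : ∀ i, Measurable (P i)) (i : ℕ) (x : ℝ) :
    ENNReal.ofReal (cdf (μ.map (P i)) x) = μ {ω | P i ω ≤ x} := by
  have := Measure.isProbabilityMeasure_map (μ := μ) (hmeas i).aemeasurable
  rw [ofReal_cdf, Measure.map_apply (hmeas i) measurableSet_Iic]
  rfl

/-- Up to null sets, `P_i ≤ x` and `F_i(P_i) ≤ F_i(x)` are the same event. -/
theorem ae_eq_cdfTransform_le (hmeas : ∀ i, Measurable (P i)) (hν : ∀ᵐ z ∂ν, 0 < z)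
    (h : IsArchimedeanMixture μ (cdfTransform μ P) ν) (i : ℕ) (x : ℝ) :
    {ω | P i ω ≤ x} =ᵐ[μ] {ω | cdfTransform μ P i ω ≤ cdf (μ.map (P i)) x} := by
  refine ae_eq_of_subset_of_measure_ge (fun ω hω => monotone_cdf _ hω) ?_
    (measurableSet_le (hmeas i) measurable_const).nullMeasurableSet (measure_ne_top _ _)
  rw [h.measure_le hν i ⟨cdf_nonneg _ _, cdf_le_one _ _⟩, ofReal_cdf_map hmeas]

/-- The positivity of `F_j(x_j)` cannot be dropped: at `0` the default value `ψ⁻¹(0) = 0` would give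
the factor `1`. That case is `measure_forall_le_eq_zero`. -/
theorem measure_forall_le (hmeas : ∀ i, Measurable (P i)) (hν : ∀ᵐ z ∂ν, 0 < z)
    (h : IsArchimedeanMixture μ (cdfTransform μ P) ν) {m : ℕ} {idx : Fin m → ℕ}
    (hidx : Function.Injective idx) {x : Fin m → ℝ}
    (hx : ∀ j, 0 < cdf (μ.map (P (idx j))) (x j)) :
    μ {ω | ∀ j, P (idx j) ω ≤ x j} = ∫⁻ z, ∏ j, ENNReal.ofReal (Real.exp
      (-(z * generatorInv (laplace ν) (cdf (μ.map (P (idx j))) (x j))))) ∂ν := by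
  rw [← h m idx hidx _ fun j => ⟨hx j, cdf_le_one _ _⟩]
  refine measure_congr ?_
  have : ∀ᵐ ω ∂μ, ∀ j, (P (idx j) ω ≤ x j) =
      (cdfTransform μ P (idx j) ω ≤ cdf (μ.map (P (idx j))) (x j)) :=
    ae_all_iff.2 fun j => ae_eq_cdfTransform_le hmeas hν h (idx j) (x j)
  filter_upwards [this] with ω hω
  exact propext (forall_congr' fun j => by rw [hω j])

theorem measure_forall_le_eq_zero (hmeas : ∀ i, Measurable (P i)) {m : ℕ} {idx : Fin m → ℕ}
    {x : Fin m → ℝ} {j : Fin m} (hx : cdf (μ.map (P (idx j))) (x j) = 0) :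
    μ {ω | ∀ j, P (idx j) ω ≤ x j} = 0 := by
  refine measure_mono_null (fun ω hω => hω j) (?_ : μ {ω | P (idx j) ω ≤ x j} = 0)
  rw [← ofReal_cdf_map hmeas, hx, ENNReal.ofReal_zero]

end Law

/-! ### Moments of the exponentially tilted mixing distribution -/

/-- `∫ z^k exp(-zs) dν(z)`, up to sign the `k`-th derivative of the Laplace transform. -/
noncomputable def laplaceMoment (ν : Measure ℝ) (k : ℕ) (s : ℝ) : ℝ≥0∞ :=
  ∫⁻ z, ENNReal.ofReal (z ^ k * Real.exp (-(z * s))) ∂ν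

section Moment

variable {ν : Measure ℝ}

/-- Log-convexity of the moments in the tilting parameter. -/
theorem laplaceMoment_mul_le (k : ℕ) {a b c d : ℝ} (hsum : a + b = c + d) (ha : a ≤ d)
    (hb : b ≤ d) :
    laplaceMoment ν k a * laplaceMoment ν k b ≤ laplaceMoment ν k c * laplaceMoment ν k d := by
  -- Tilting by the largest parameter `d` turns the moments at `a` and `b` into integrals of the
  -- nondecreasing functions `exp(z(d - a))` and `exp(z(d - b))`, to which Chebyshev's inequality
  -- applies. Their product is `exp(z(d - c))`.
  set w : ℝ → ℝ≥0∞ := fun z => ENNReal.ofReal (z ^ k * Real.exp (-(z * d)))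
  have hw : Measurable w := by fun_prop
  have hexp : ∀ r, Measurable fun z : ℝ => ENNReal.ofReal (Real.exp (z * r)) := fun r => by
    fun_prop
  have htilt : ∀ s r, r = d - s →
      ∫⁻ z, ENNReal.ofReal (Real.exp (z * r)) ∂(ν.withDensity w) = laplaceMoment ν k s := by
    rintro s r rfl
    rw [lintegral_withDensity_eq_lintegral_mul _ hw (hexp _)]
    refine lintegral_congr fun z => ?_
    simp only [Pi.mul_apply, w]
    rw [← ENNReal.ofReal_mul' (Real.exp_pos _).le, mul_assoc, ← Real.exp_add]
    ring_nf
  have hmono : ∀ r, 0 ≤ r → MonotoneOn (fun z : ℝ => ENNReal.ofReal (Real.exp (z * r))) univ :=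
    fun r hr x _ y _ hxy => ENNReal.ofReal_le_ofReal (Real.exp_le_exp.2 (by gcongr))
  have key := lintegral_mul_lintegral_le_of_monotoneOn (μ := ν.withDensity w) (s := univ)
    (by simp) (hexp (d - a)) (hexp (d - b)) (hmono _ (by linarith)) (hmono _ (by linarith))
  rw [htilt a _ rfl, htilt b _ rfl] at key
  have h0 : ν.withDensity w univ = laplaceMoment ν k d := by
    rw [← htilt d 0 (by ring)]; simp
  have h1 : ∫⁻ z, ENNReal.ofReal (Real.exp (z * (d - a))) * ENNReal.ofReal (Real.exp (z * (d - b)))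
      ∂(ν.withDensity w) = laplaceMoment ν k c := by
    rw [← htilt c _ rfl]
    refine lintegral_congr fun z => ?_
    rw [← ENNReal.ofReal_mul (Real.exp_pos _).le, ← Real.exp_add]
    congr 2
    have : c = a + b - d := by linarith
    rw [this]; ring
  rw [h0, h1, mul_comm (laplaceMoment ν k d)] at key
  exact key

variable [IsProbabilityMeasure ν]

theorem measurable_laplaceMoment (k : ℕ) : Measurable (laplaceMoment ν k) := by
  have : Measurable fun x : ℝ × ℝ => ENNReal.ofReal (x.2 ^ k * Real.exp (-(x.2 * x.1))) := by
    fun_prop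
  exact this.lintegral_prod_right'

theorem laplaceMoment_ne_top (hν : ∀ᵐ z ∂ν, 0 < z) (k : ℕ) {s : ℝ} (hs : 0 < s) :
    laplaceMoment ν k s ≠ ∞ := by
  have hle : laplaceMoment ν k s ≤ ∫⁻ _, ENNReal.ofReal (k.factorial / s ^ k) ∂ν := by
    refine lintegral_mono_ae (hν.mono fun z hz => ENNReal.ofReal_le_ofReal ?_)
    -- One term of the exponential series gives `z^k exp(-zs) ≤ k! / s^k`.
    have h := Real.pow_div_factorial_le_exp (z * s) (by positivity) k
    rw [Real.exp_neg, ← div_eq_mul_inv, div_le_div_iff₀ (Real.exp_pos _) (by positivity),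
      ← mul_pow]
    rw [div_le_iff₀ (by positivity)] at h
    linarith
  refine ne_top_of_le_ne_top ?_ hle
  simp

theorem laplaceMoment_ne_zero (hν : ∀ᵐ z ∂ν, 0 < z) (k : ℕ) (s : ℝ) :
    laplaceMoment ν k s ≠ 0 := by
  intro h
  rw [laplaceMoment, lintegral_eq_zero_iff (by fun_prop)] at h
  obtain ⟨z, hz, hz0⟩ := (hν.and h).exists
  have : 0 < z ^ k * Real.exp (-(z * s)) := by positivity
  exact (ENNReal.ofReal_pos.2 this).ne' hz0

theorem Ioi_inter_laplace_le_ae_eq (hν : ∀ᵐ z ∂ν, 0 < z) {v : ℝ} (hv : 0 < v) :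
    (laplace ν ⁻¹' Iic v ∩ Ioi 0 : Set ℝ) =ᵐ[volume] Ioi (generatorInv (laplace ν) v) := by
  have h1 : (laplace ν ⁻¹' Iic v ∩ Ioi 0 : Set ℝ) = Ici (generatorInv (laplace ν) v) ∩ Ioi 0 := by
    ext t
    simp only [mem_inter_iff, mem_preimage, mem_Iic, mem_Ici, mem_Ioi, and_congr_left_iff]
    exact fun ht => (generatorInv_le_iff hν hv ht.le).symm
  have h2 : (Ioi (generatorInv (laplace ν) v) ∩ Ioi 0 : Set ℝ) = Ioi (generatorInv (laplace ν) v) :=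
    inter_eq_left.2 (Ioi_subset_Ioi (generatorInv_nonneg _ _))
  rw [h1]
  conv_rhs => rw [← h2]
  exact Ioi_ae_eq_Ici.symm.inter (ae_eq_refl _)

/-- Tonelli reduces this to exponential tails, so that `M_1` acts as `-ψ'` without differentiating
`ψ`. -/
theorem setLIntegral_Ioi_laplaceMoment_one (hν : ∀ᵐ z ∂ν, 0 < z) {a : ℝ} (ha : 0 ≤ a) :
    ∫⁻ t in Ioi a, laplaceMoment ν 1 t = ENNReal.ofReal (laplace ν a) := by
  simp only [laplaceMoment, pow_one]
  rw [lintegral_lintegral_swap (by fun_prop), ofReal_laplace hν ha]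
  exact lintegral_congr_ae (hν.mono fun z hz => lintegral_Ioi_exp hz a)

end Moment

/-! ### Densities -/

section Density

variable {Ω : Type*} [MeasurableSpace Ω] {μ : Measure Ω}
  {P : ℕ → Ω → ℝ} {ν : Measure ℝ}

/-- The univariate factors of the joint density. -/
noncomputable def marginalWeight (μ : Measure Ω) (P : ℕ → Ω → ℝ) (ν : Measure ℝ) (i : ℕ) (x : ℝ) :
    ℝ≥0 :=
  (cdf (μ.map (P i)) ⁻¹' Ioo 0 1).indicator (fun x => ((μ.map (P i)).rnDeriv volume x).toNNReal *
    (laplaceMoment ν 1 (generatorInv (laplace ν) (cdf (μ.map (P i)) x)))⁻¹.toNNReal) x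

theorem cdf_mem_Ioo_of_marginalWeight_ne_zero {i : ℕ} {x : ℝ} (h : marginalWeight μ P ν i x ≠ 0) :
    cdf (μ.map (P i)) x ∈ Ioo (0 : ℝ) 1 :=
  mem_of_indicator_ne_zero (s := cdf (μ.map (P i)) ⁻¹' Ioo 0 1) h

variable [IsProbabilityMeasure ν]

theorem measurable_marginalWeight (hν : ∀ᵐ z ∂ν, 0 < z) (i : ℕ) :
    Measurable (marginalWeight μ P ν i) := by
  have hc : Measurable (cdf (μ.map (P i))) := (monotone_cdf _).measurable
  refine Measurable.indicator ?_ (hc measurableSet_Ioo)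
  exact (Measure.measurable_rnDeriv _ _).ennreal_toNNReal.mul
    ((measurable_laplaceMoment 1).comp ((measurable_generatorInv hν).comp hc)).inv.ennreal_toNNReal

/-- The joint density of `P_{i_1}, …, P_{i_m}`. -/
noncomputable def jointDensity (μ : Measure Ω) (P : ℕ → Ω → ℝ) (ν : Measure ℝ) {m : ℕ}
    (idx : Fin m → ℕ) (x : Fin m → ℝ) : ℝ≥0 :=
  (∏ j, marginalWeight μ P ν (idx j) (x j)) *
    (laplaceMoment ν m (∑ j, generatorInv (laplace ν) (cdf (μ.map (P (idx j))) (x j)))).toNNReal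

theorem measurable_sum_generatorInv (hν : ∀ᵐ z ∂ν, 0 < z) {m : ℕ} (idx : Fin m → ℕ) :
    Measurable fun x : Fin m → ℝ =>
      ∑ j, generatorInv (laplace ν) (cdf (μ.map (P (idx j))) (x j)) :=
  Finset.measurable_sum _ fun j _ => (measurable_generatorInv hν).comp
    ((monotone_cdf _).measurable.comp (measurable_pi_apply j))

theorem measurable_jointDensity (hν : ∀ᵐ z ∂ν, 0 < z) {m : ℕ} (idx : Fin m → ℕ) :
    Measurable (jointDensity μ P ν idx) :=
  (Finset.measurable_prod _ fun j _ =>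
    (measurable_marginalWeight hν (idx j)).comp (measurable_pi_apply j)).mul
    ((measurable_laplaceMoment m).comp (measurable_sum_generatorInv hν idx)).ennreal_toNNReal

theorem laplaceMoment_sum_ne_top (hν : ∀ᵐ z ∂ν, 0 < z) {m : ℕ} (hm : 0 < m) {idx : Fin m → ℕ}
    {x : Fin m → ℝ} (hx : ∀ j, cdf (μ.map (P (idx j))) (x j) ∈ Ioo (0 : ℝ) 1) :
    laplaceMoment ν m (∑ j, generatorInv (laplace ν) (cdf (μ.map (P (idx j))) (x j))) ≠ ∞ :=
  laplaceMoment_ne_top hν m (Finset.sum_pos (fun j _ => generatorInv_pos hν (hx j))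
    ⟨⟨0, hm⟩, Finset.mem_univ _⟩)

/-- Conditional independence at the level of densities: given `Z = z` the density is a product, so
Tonelli can treat the coordinates separately. -/
theorem coe_jointDensity (hν : ∀ᵐ z ∂ν, 0 < z) {m : ℕ} (hm : 0 < m) (idx : Fin m → ℕ)
    (x : Fin m → ℝ) :
    (jointDensity μ P ν idx x : ℝ≥0∞) =
      ∫⁻ z, ∏ j, ((marginalWeight μ P ν (idx j) (x j) : ℝ≥0∞) * ENNReal.ofReal
        (z * Real.exp (-(z * generatorInv (laplace ν) (cdf (μ.map (P (idx j))) (x j)))))) ∂ν := by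
  have hint : ∫⁻ z, ∏ j, ((marginalWeight μ P ν (idx j) (x j) : ℝ≥0∞) * ENNReal.ofReal
        (z * Real.exp (-(z * generatorInv (laplace ν) (cdf (μ.map (P (idx j))) (x j)))))) ∂ν =
      (∏ j, (marginalWeight μ P ν (idx j) (x j) : ℝ≥0∞)) * laplaceMoment ν m
        (∑ j, generatorInv (laplace ν) (cdf (μ.map (P (idx j))) (x j))) := by
    rw [laplaceMoment, ← lintegral_const_mul _ (by fun_prop)]
    refine lintegral_congr_ae (hν.mono fun z hz => ?_)
    dsimp only
    rw [Finset.prod_mul_distrib, ← ENNReal.ofReal_prod_of_nonneg fun j _ => by positivity,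
      Finset.prod_mul_distrib, Finset.prod_const, Finset.card_univ, Fintype.card_fin,
      ← Real.exp_sum, Finset.sum_neg_distrib, ← Finset.mul_sum]
  rw [hint, jointDensity, ENNReal.coe_mul, ENNReal.ofNNReal_finsetProd]
  -- The truncation by `toNNReal` is harmless: nonzero weights put every `F_j(x_j)` in `(0, 1)`, so
  -- the time sum is positive and the moment is finite.
  by_cases h0 : ∏ j, (marginalWeight μ P ν (idx j) (x j) : ℝ≥0∞) = 0
  · rw [h0, zero_mul, zero_mul]
  · rw [ENNReal.coe_toNNReal (laplaceMoment_sum_ne_top hν hm fun j => ?_)]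
    refine cdf_mem_Ioo_of_marginalWeight_ne_zero (ν := ν) fun hj => h0 ?_
    exact Finset.prod_eq_zero (Finset.mem_univ j) (by rw [hj, ENNReal.coe_zero])

theorem jointDensity_mul_le (hν : ∀ᵐ z ∂ν, 0 < z) {m : ℕ} (hm : 0 < m) (idx : Fin m → ℕ)
    (x y : Fin m → ℝ) :
    jointDensity μ P ν idx x * jointDensity μ P ν idx y ≤
      jointDensity μ P ν idx (x ⊔ y) * jointDensity μ P ν idx (x ⊓ y) := by
  set T : Fin m → ℝ → ℝ := fun j u => generatorInv (laplace ν) (cdf (μ.map (P (idx j))) u) with hT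
  by_cases h0 : jointDensity μ P ν idx x * jointDensity μ P ν idx y = 0
  · rw [h0]; exact zero_le
  obtain ⟨hx0, hy0⟩ := mul_ne_zero_iff.1 h0
  have hx : ∀ j, cdf (μ.map (P (idx j))) (x j) ∈ Ioo (0 : ℝ) 1 := fun j =>
    cdf_mem_Ioo_of_marginalWeight_ne_zero
      (Finset.prod_ne_zero_iff.1 (left_ne_zero_of_mul hx0) j (Finset.mem_univ j))
  have hy : ∀ j, cdf (μ.map (P (idx j))) (y j) ∈ Ioo (0 : ℝ) 1 := fun j =>
    cdf_mem_Ioo_of_marginalWeight_ne_zero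
      (Finset.prod_ne_zero_iff.1 (left_ne_zero_of_mul hy0) j (Finset.mem_univ j))
  have hsup : ∀ j, cdf (μ.map (P (idx j))) ((x ⊔ y) j) ∈ Ioo (0 : ℝ) 1 := fun j => by
    rcases le_total (x j) (y j) with hj | hj
    · rw [Pi.sup_apply, sup_of_le_right hj]; exact hy j
    · rw [Pi.sup_apply, sup_of_le_left hj]; exact hx j
  have hinf : ∀ j, cdf (μ.map (P (idx j))) ((x ⊓ y) j) ∈ Ioo (0 : ℝ) 1 := fun j => by
    rcases le_total (x j) (y j) with hj | hj
    · rw [Pi.inf_apply, inf_of_le_left hj]; exact hx j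
    · rw [Pi.inf_apply, inf_of_le_right hj]; exact hy j
  have hTanti : ∀ j u v, 0 < cdf (μ.map (P (idx j))) u → u ≤ v → T j v ≤ T j u :=
    fun j u v hu huv => generatorInv_antitoneOn hν hu
      (hu.trans_le (monotone_cdf _ huv)) (monotone_cdf _ huv)
  have hprod : (∏ j, marginalWeight μ P ν (idx j) (x j)) *
      (∏ j, marginalWeight μ P ν (idx j) (y j)) =
      (∏ j, marginalWeight μ P ν (idx j) ((x ⊔ y) j)) *
      (∏ j, marginalWeight μ P ν (idx j) ((x ⊓ y) j)) := by
    rw [← Finset.prod_mul_distrib, ← Finset.prod_mul_distrib]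
    refine Finset.prod_congr rfl fun j _ => ?_
    rcases le_total (x j) (y j) with hj | hj
    · rw [Pi.sup_apply, Pi.inf_apply, sup_of_le_right hj, inf_of_le_left hj, mul_comm]
    · rw [Pi.sup_apply, Pi.inf_apply, sup_of_le_left hj, inf_of_le_right hj]
  have hsum : (∑ j, T j (x j)) + ∑ j, T j (y j) =
      (∑ j, T j ((x ⊔ y) j)) + ∑ j, T j ((x ⊓ y) j) := by
    rw [← Finset.sum_add_distrib, ← Finset.sum_add_distrib]
    refine Finset.sum_congr rfl fun j _ => ?_
    rcases le_total (x j) (y j) with hj | hj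
    · rw [Pi.sup_apply, Pi.inf_apply, sup_of_le_right hj, inf_of_le_left hj, add_comm]
    · rw [Pi.sup_apply, Pi.inf_apply, sup_of_le_left hj, inf_of_le_right hj]
  -- Times decrease in the p-values, so the time sum at `x ⊓ y` is the largest one and plays the
  -- role of `d`.
  have hmoment := laplaceMoment_mul_le (ν := ν) m hsum
    (Finset.sum_le_sum fun j _ => hTanti j _ _ (hinf j).1 inf_le_left)
    (Finset.sum_le_sum fun j _ => hTanti j _ _ (hinf j).1 inf_le_right)
  have hmoment' : (laplaceMoment ν m (∑ j, T j (x j))).toNNReal *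
      (laplaceMoment ν m (∑ j, T j (y j))).toNNReal ≤
      (laplaceMoment ν m (∑ j, T j ((x ⊔ y) j))).toNNReal *
      (laplaceMoment ν m (∑ j, T j ((x ⊓ y) j))).toNNReal := by
    rw [← ENNReal.toNNReal_mul, ← ENNReal.toNNReal_mul]
    exact ENNReal.toNNReal_mono (ENNReal.mul_ne_top (laplaceMoment_sum_ne_top hν hm hsup)
      (laplaceMoment_sum_ne_top hν hm hinf)) hmoment
  simp only [jointDensity]
  rw [mul_mul_mul_comm, hprod,
    mul_mul_mul_comm _ _ (∏ j, marginalWeight μ P ν (idx j) ((x ⊓ y) j))]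
  exact mul_le_mul_right hmoment' _

variable [IsProbabilityMeasure μ]

/-- The `F_i(P_i)` are distributed like `ψ(T)`, where `T` has density `-ψ'`. -/
theorem map_cdfTransform_eq (hmeas : ∀ i, Measurable (P i)) (hν : ∀ᵐ z ∂ν, 0 < z)
    (h : IsArchimedeanMixture μ (cdfTransform μ P) ν) (i : ℕ) :
    μ.map (cdfTransform μ P i) =
      ((volume.restrict (Ioi 0)).withDensity (laplaceMoment ν 1)).map (laplace ν) := by
  have hU := measurable_cdfTransform (μ := μ) hmeas i
  have := Measure.isProbabilityMeasure_map (μ := μ) hU.aemeasurable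
  refine Measure.ext_of_Iic _ _ fun v => ?_
  have hpre : MeasurableSet (laplace ν ⁻¹' Iic v) := measurable_laplace measurableSet_Iic
  rw [Measure.map_apply hU measurableSet_Iic, Measure.map_apply measurable_laplace measurableSet_Iic,
    withDensity_apply _ hpre, Measure.restrict_restrict hpre]
  rcases le_or_gt v 0 with hv | hv
  · have h1 : μ (cdfTransform μ P i ⁻¹' Iic v) = 0 := by
      have h0 := h.measure_le hν i (v := 0) ⟨le_rfl, zero_le_one⟩
      rw [ENNReal.ofReal_zero] at h0
      exact measure_mono_null (fun ω (hω : _ ≤ v) => hω.trans hv) h0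
    have h2 : (laplace ν ⁻¹' Iic v ∩ Ioi 0 : Set ℝ) = ∅ :=
      eq_empty_of_forall_notMem fun t ht =>
        (le_trans ht.1 hv : laplace ν t ≤ 0).not_gt (laplace_pos hν (le_of_lt ht.2))
    rw [h1, h2, Measure.restrict_empty, lintegral_zero_measure]
  · rw [setLIntegral_congr (Ioi_inter_laplace_le_ae_eq hν hv),
      setLIntegral_Ioi_laplaceMoment_one hν (generatorInv_nonneg _ _)]
    rcases le_or_gt v 1 with hv1 | hv1
    · rw [laplace_generatorInv hν ⟨hv, hv1⟩]
      exact h.measure_le hν i ⟨hv.le, hv1⟩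
    · have h0 : generatorInv (laplace ν) v = 0 :=
        le_antisymm ((generatorInv_le_iff hν hv le_rfl).2 (by rw [laplace_zero]; exact hv1.le))
          (generatorInv_nonneg _ _)
      have h1 : cdfTransform μ P i ⁻¹' Iic v = univ :=
        eq_univ_of_forall fun ω => (cdfTransform_mem_Icc i ω).2.trans hv1.le
      rw [h0, h1, laplace_zero, measure_univ, ENNReal.ofReal_one]

/-- The distribution function of `P_i` given `Z = z`. -/
theorem setLIntegral_marginalWeight (hmeas : ∀ i, Measurable (P i))
    (hac : ∀ i, μ.map (P i) ≪ volume) (hν : ∀ᵐ z ∂ν, 0 < z)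
    (h : IsArchimedeanMixture μ (cdfTransform μ P) ν) (i : ℕ) {z : ℝ} (hz : 0 < z) (x : ℝ) :
    ∫⁻ y in Iic x, (marginalWeight μ P ν i y : ℝ≥0∞) *
        ENNReal.ofReal (z * Real.exp (-(z * generatorInv (laplace ν) (cdf (μ.map (P i)) y)))) =
      if cdf (μ.map (P i)) x = 0 then 0 else
        ENNReal.ofReal (Real.exp (-(z * generatorInv (laplace ν) (cdf (μ.map (P i)) x)))) := by
  set F := cdf (μ.map (P i)) with hF
  have hFm : Measurable F := (monotone_cdf _).measurable
  have hprob := Measure.isProbabilityMeasure_map (μ := μ) (hmeas i).aemeasurable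
  have hU := measurable_cdfTransform (μ := μ) hmeas i
  -- The integrand without the marginal density, as a function of `u = F y`. The integral is carried
  -- from `y` to `P_i`, then to `F_i(P_i)`, then to the time `t` with `u = ψ(t)`. There the density
  -- `M_1(t)` cancels the inverse moment and leaves the exponential density with rate `z`.
  set G : ℝ → ℝ≥0∞ := (Ioo (0 : ℝ) 1).indicator fun u =>
    (laplaceMoment ν 1 (generatorInv (laplace ν) u))⁻¹ *
      ENNReal.ofReal (z * Real.exp (-(z * generatorInv (laplace ν) u))) with hG
  have hinv := measurable_generatorInv hν
  have hGm : Measurable G := by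
    refine Measurable.indicator ?_ measurableSet_Ioo
    exact ((measurable_laplaceMoment 1).comp hinv).inv.mul (by fun_prop)
  have hGψ : Measurable fun t => G (laplace ν t) := hGm.comp measurable_laplace
  have hGF : Measurable fun y => G (F y) := hGm.comp hFm
  have hweight : ∫⁻ y in Iic x, (marginalWeight μ P ν i y : ℝ≥0∞) *
        ENNReal.ofReal (z * Real.exp (-(z * generatorInv (laplace ν) (F y)))) =
      ∫⁻ y in Iic x, (μ.map (P i)).rnDeriv volume y * G (F y) := by
    refine lintegral_congr_ae (ae_restrict_of_ae ?_)
    filter_upwards [Measure.rnDeriv_lt_top (μ.map (P i)) volume] with y hy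
    by_cases hy1 : F y ∈ Ioo (0 : ℝ) 1
    · rw [marginalWeight, indicator_of_mem (show y ∈ F ⁻¹' Ioo 0 1 from hy1), hG,
        indicator_of_mem hy1, ENNReal.coe_mul, ENNReal.coe_toNNReal hy.ne,
        ENNReal.coe_toNNReal (ENNReal.inv_ne_top.2 (laplaceMoment_ne_zero hν _ _)), mul_assoc]
    · rw [marginalWeight, indicator_of_notMem (show y ∉ F ⁻¹' Ioo 0 1 from hy1), hG,
        indicator_of_notMem hy1]
      simp
  have hpre : MeasurableSet (laplace ν ⁻¹' Iic (F x)) := measurable_laplace measurableSet_Iic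
  rw [hweight, setLIntegral_rnDeriv_mul (hac i) hGF.aemeasurable measurableSet_Iic,
    setLIntegral_map measurableSet_Iic hGF (hmeas i),
    setLIntegral_congr (s := P i ⁻¹' Iic x) (t := cdfTransform μ P i ⁻¹' Iic (F x))
      (ae_eq_cdfTransform_le hmeas hν h i x)]
  change ∫⁻ ω in cdfTransform μ P i ⁻¹' Iic (F x), G (cdfTransform μ P i ω) ∂μ = _
  rw [← setLIntegral_map measurableSet_Iic hGm hU, map_cdfTransform_eq hmeas hν h,
    setLIntegral_map measurableSet_Iic hGm measurable_laplace,
    setLIntegral_withDensity_eq_setLIntegral_mul _ (measurable_laplaceMoment 1)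
      hGψ hpre, Measure.restrict_restrict hpre]
  have hcongr : ∫⁻ t in laplace ν ⁻¹' Iic (F x) ∩ Ioi 0,
      (laplaceMoment ν 1 * fun t => G (laplace ν t)) t =
      ∫⁻ t in laplace ν ⁻¹' Iic (F x) ∩ Ioi 0, ENNReal.ofReal (z * Real.exp (-(z * t))) := by
    refine setLIntegral_congr_fun (hpre.inter measurableSet_Ioi) fun t ht => ?_
    have ht0 : 0 < t := ht.2
    simp only [Pi.mul_apply, hG]
    rw [indicator_of_mem (laplace_mem_Ioo hν ht0), generatorInv_laplace hν ht0.le, ← mul_assoc,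
      ENNReal.mul_inv_cancel (laplaceMoment_ne_zero hν _ _) (laplaceMoment_ne_top hν _ ht0), one_mul]
  refine hcongr.trans ?_
  -- At `F x = 0` the default `ψ⁻¹(0) = 0` would make the exponential `1`, whereas the region of
  -- integration is empty because `ψ > 0`.
  split_ifs with h0
  · have h2 : (laplace ν ⁻¹' Iic (F x) ∩ Ioi 0 : Set ℝ) = ∅ :=
      eq_empty_of_forall_notMem fun t ht =>
        (le_trans ht.1 h0.le : laplace ν t ≤ 0).not_gt (laplace_pos hν (le_of_lt ht.2))
    rw [h2, Measure.restrict_empty, lintegral_zero_measure]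
  · have hpos : 0 < F x := (cdf_nonneg _ _).lt_of_ne (Ne.symm h0)
    rw [setLIntegral_congr (Ioi_inter_laplace_le_ae_eq hν hpos), lintegral_Ioi_exp hz]

/-- Distribution functions are compared: after Tonelli, the integral over a box factorizes for each
`z` into the conditional distribution functions. -/
theorem map_eq_withDensity_jointDensity (hmeas : ∀ i, Measurable (P i))
    (hac : ∀ i, μ.map (P i) ≪ volume) (hν : ∀ᵐ z ∂ν, 0 < z)
    (h : IsArchimedeanMixture μ (cdfTransform μ P) ν) {m : ℕ} (hm : 0 < m) {idx : Fin m → ℕ}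
    (hidx : Function.Injective idx) :
    μ.map (fun ω j => P (idx j) ω) =
      volume.withDensity fun x => (jointDensity μ P ν idx x : ℝ≥0∞) := by
  have hPm : Measurable fun ω j => P (idx j) ω := measurable_pi_lambda _ fun j => hmeas _
  have := Measure.isProbabilityMeasure_map (μ := μ) hPm.aemeasurable
  have hc : ∀ i, Measurable (cdf (μ.map (P i))) := fun i => (monotone_cdf _).measurable
  have hinv := measurable_generatorInv hν
  refine Measure.pi_ext_of_Iic _ _ fun x => ?_
  have hswap : ∫⁻ y in Iic x, (jointDensity μ P ν idx y : ℝ≥0∞) =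
      ∫⁻ z, ∏ j, (if cdf (μ.map (P (idx j))) (x j) = 0 then 0 else ENNReal.ofReal (Real.exp
        (-(z * generatorInv (laplace ν) (cdf (μ.map (P (idx j))) (x j)))))) ∂ν := by
    simp_rw [coe_jointDensity hν hm idx]
    rw [lintegral_lintegral_swap]
    · refine lintegral_congr_ae (hν.mono fun z hz => ?_)
      dsimp only
      rw [← pi_univ_Iic, setLIntegral_pi_prod (fun j => Iic (x j))
        (f := fun j y => (marginalWeight μ P ν (idx j) y : ℝ≥0∞) * ENNReal.ofReal
          (z * Real.exp (-(z * generatorInv (laplace ν) (cdf (μ.map (P (idx j))) y)))))]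
      · exact Finset.prod_congr rfl fun j _ =>
          setLIntegral_marginalWeight hmeas hac hν h (idx j) hz (x j)
      · intro j
        have := hinv.comp (hc (idx j))
        exact (measurable_marginalWeight hν (idx j)).coe_nnreal_ennreal.mul (by fun_prop)
    · refine (Finset.measurable_prod _ fun j _ => ?_).aemeasurable
      have hxj : Measurable fun q : (Fin m → ℝ) × ℝ => q.1 j :=
        (measurable_pi_apply j).comp measurable_fst
      have := hinv.comp ((hc (idx j)).comp hxj)
      exact ((measurable_marginalWeight hν (idx j)).comp hxj).coe_nnreal_ennreal.mul
        (by fun_prop)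
  rw [Measure.map_apply hPm measurableSet_Iic, withDensity_apply _ measurableSet_Iic, hswap]
  change μ {ω | ∀ j, P (idx j) ω ≤ x j} = _
  by_cases hx : ∀ j, 0 < cdf (μ.map (P (idx j))) (x j)
  · rw [measure_forall_le hmeas hν h hidx hx]
    simp only [(hx _).ne', if_false]
  · push Not at hx
    obtain ⟨j, hj⟩ := hx
    have hj0 := le_antisymm hj (cdf_nonneg _ _)
    rw [measure_forall_le_eq_zero hmeas hj0]
    refine ((lintegral_congr fun z => ?_).trans lintegral_zero).symm
    exact Finset.prod_eq_zero (Finset.mem_univ j) (if_pos hj0)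

/-- The joint laws of the `P_i` are multivariate totally positive of order 2. -/
theorem isMTP2_map (hmeas : ∀ i, Measurable (P i)) (hac : ∀ i, μ.map (P i) ≪ volume)
    (hν : ∀ᵐ z ∂ν, 0 < z) (h : IsArchimedeanMixture μ (cdfTransform μ P) ν) {m : ℕ} (hm : 0 < m)
    {idx : Fin m → ℕ} (hidx : Function.Injective idx) :
    IsMTP2 (μ.map (fun ω j => P (idx j) ω)) :=
  ⟨jointDensity μ P ν idx, measurable_jointDensity hν idx,
    map_eq_withDensity_jointDensity hmeas hac hν h hm hidx, jointDensity_mul_le hν hm idx⟩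

end Density

/-! ### Quantile functions -/

/-- The quantile function of a law `ρ` on the line, restricted to `(0, 1)`. -/
noncomputable def quantile (ρ : Measure ℝ) : ℝ → ℝ :=
  (Ioo (0 : ℝ) 1).indicator fun u => sInf {x | u ≤ cdf ρ x}

/-- Right continuity of the distribution function puts the infimum in the set, and the limits at
`±∞` make the set bounded below and nonempty for `0 < u < 1`. -/
theorem quantile_le_iff (ρ : Measure ℝ) {u x : ℝ} (hu : u ∈ Ioo (0 : ℝ) 1) :
    quantile ρ u ≤ x ↔ u ≤ cdf ρ x := by
  rw [quantile, indicator_of_mem hu]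
  have hbdd : BddBelow {x | u ≤ cdf ρ x} := by
    obtain ⟨b, hb⟩ := ((tendsto_cdf_atBot ρ).eventually_lt_const hu.1).exists
    exact ⟨b, fun y hy => le_of_not_gt fun hyb =>
      (hb.trans_le hy).not_ge (monotone_cdf ρ hyb.le)⟩
  have hne : {x | u ≤ cdf ρ x}.Nonempty := by
    obtain ⟨b, hb⟩ := ((tendsto_cdf_atTop ρ).eventually_const_lt hu.2).exists
    exact ⟨b, hb.le⟩
  refine ⟨fun h => le_trans ?_ (monotone_cdf ρ h), fun h => csInf_le hbdd h⟩
  have hlim : Tendsto (cdf ρ) (𝓝[>] (sInf {x | u ≤ cdf ρ x}))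
      (𝓝 (cdf ρ (sInf {x | u ≤ cdf ρ x}))) :=
    ((cdf ρ).right_continuous _).mono_left (nhdsWithin_mono _ Ioi_subset_Ici_self)
  refine ge_of_tendsto hlim (eventually_nhdsWithin_of_forall fun y hy => ?_)
  obtain ⟨x, hx, hxy⟩ := (csInf_lt_iff hbdd hne).1 hy
  exact le_trans hx (monotone_cdf ρ hxy.le)

theorem quantile_monotoneOn (ρ : Measure ℝ) : MonotoneOn (quantile ρ) (Ioo 0 1) :=
  fun _ hu _ hv huv => (quantile_le_iff ρ hu).2 (huv.trans ((quantile_le_iff ρ hv).1 le_rfl))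

theorem measurable_quantile (ρ : Measure ℝ) : Measurable (quantile ρ) := by
  refine measurable_of_Iic fun x => ?_
  have : quantile ρ ⁻¹' Iic x =
      (Ioo 0 1 ∩ Iic (cdf ρ x)) ∪ ((Ioo 0 1)ᶜ ∩ {_u : ℝ | 0 ≤ x}) := by
    ext u
    by_cases hu : u ∈ Ioo (0 : ℝ) 1
    · simp only [mem_preimage, mem_Iic, mem_union, mem_inter_iff, mem_compl_iff, hu, not_true,
        true_and, false_and, or_false]
      exact quantile_le_iff ρ hu
    · simp only [mem_preimage, mem_Iic, mem_union, mem_inter_iff, mem_compl_iff, hu,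
        not_false_eq_true, true_and, false_and, false_or, mem_ofPred_eq]
      rw [quantile, indicator_of_notMem hu]
  rw [this]
  exact (measurableSet_Ioo.inter measurableSet_Iic).union
    (measurableSet_Ioo.compl.inter (MeasurableSet.const _))

/-! ### Independent standard exponential variables -/

/-- The density of the standard exponential distribution. -/
noncomputable def expDensity : ℝ → ℝ≥0∞ :=
  (Ici (0 : ℝ)).indicator fun t => ENNReal.ofReal (Real.exp (-t))

/-- The law of `m` independent standard exponential random variables. -/
noncomputable def expPi (m : ℕ) : Measure (Fin m → ℝ) :=
  volume.withDensity fun e => ∏ j, expDensity (e j)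

theorem measurable_expDensity : Measurable expDensity :=
  Measurable.indicator (by fun_prop) measurableSet_Ici

theorem measurable_prod_expDensity (m : ℕ) :
    Measurable fun e : Fin m → ℝ => ∏ j, expDensity (e j) :=
  Finset.measurable_prod _ fun j _ => measurable_expDensity.comp (measurable_pi_apply j)

theorem setLIntegral_Ici_expDensity {c : ℝ} (hc : 0 ≤ c) :
    ∫⁻ t in Ici c, expDensity t = ENNReal.ofReal (Real.exp (-c)) := by
  have h : ∫⁻ t in Ici c, expDensity t =
      ∫⁻ t in Ici c, ENNReal.ofReal (1 * Real.exp (-(1 * t))) := by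
    refine setLIntegral_congr_fun measurableSet_Ici fun t ht => ?_
    rw [expDensity, indicator_of_mem (show t ∈ Ici (0 : ℝ) from hc.trans ht), one_mul, one_mul]
  rw [h, setLIntegral_congr Ioi_ae_eq_Ici.symm, lintegral_Ioi_exp one_pos, one_mul]

theorem expPi_forall_le {m : ℕ} {c : Fin m → ℝ} (hc : ∀ j, 0 ≤ c j) :
    expPi m {e | ∀ j, c j ≤ e j} = ∏ j, ENNReal.ofReal (Real.exp (-c j)) := by
  have hset : {e : Fin m → ℝ | ∀ j, c j ≤ e j} = Set.pi univ fun j => Ici (c j) := by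
    ext e; simp [Pi.le_def]
  rw [hset, expPi, withDensity_apply _ (MeasurableSet.univ_pi fun _ => measurableSet_Ici),
    setLIntegral_pi_prod _ fun _ => measurable_expDensity]
  exact Finset.prod_congr rfl fun j _ => setLIntegral_Ici_expDensity (hc j)

instance isProbabilityMeasure_expPi (m : ℕ) : IsProbabilityMeasure (expPi m) := by
  refine ⟨?_⟩
  have h : ∫⁻ t, expDensity t = 1 := by
    have h0 := setLIntegral_Ici_expDensity (le_refl (0 : ℝ))
    rw [neg_zero, Real.exp_zero, ENNReal.ofReal_one] at h0
    rw [← h0, ← lintegral_indicator measurableSet_Ici, expDensity, indicator_indicator,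
      inter_self]
  rw [expPi, withDensity_apply _ MeasurableSet.univ, Measure.restrict_univ, volume_pi,
    lintegral_pi_prod _ fun _ => measurable_expDensity]
  simp [h]

theorem ae_expPi_pos (m : ℕ) : ∀ᵐ e ∂(expPi m), ∀ j, 0 < e j := by
  rw [expPi, ae_withDensity_iff (measurable_prod_expDensity m)]
  have h : ∀ᵐ e : Fin m → ℝ, ∀ j, e j ≠ 0 := ae_all_iff.2 fun j => by
    rw [volume_pi]; exact Measure.ae_eval_ne (fun _ => volume) j 0
  refine h.mono fun e he hne j => ?_
  exact lt_of_le_of_ne (mem_of_indicator_ne_zero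
    (Finset.prod_ne_zero_iff.1 hne j (Finset.mem_univ j))) (he j).symm

/-- The lack of memory of the exponential distribution, in one coordinate. -/
theorem expPi_inter_le {m : ℕ} (i : Fin m) {c : ℝ} (hc : 0 ≤ c) {A : Set (Fin m → ℝ)}
    (hA : MeasurableSet A) :
    expPi m ({e | c ≤ e i} ∩ A) =
      ENNReal.ofReal (Real.exp (-c)) * expPi m {e : Fin m → ℝ | e + Pi.single i c ∈ A} := by
  have hS : MeasurableSet ({e : Fin m → ℝ | c ≤ e i} ∩ A) :=
    (measurableSet_le measurable_const (measurable_pi_apply i)).inter hA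
  have hA' : MeasurableSet {e : Fin m → ℝ | e + Pi.single i c ∈ A} :=
    measurable_add_const (Pi.single i c : Fin m → ℝ) hA
  -- Translation by `c` in coordinate `i` preserves Lebesgue measure, carries `{0 ≤ e i}` onto `{c ≤
  -- e i}`, and multiplies the density there by `exp(-c)`.
  rw [expPi, withDensity_apply _ hS, withDensity_apply _ hA', ← lintegral_indicator hS,
    ← lintegral_indicator hA', ← lintegral_add_right_eq_self _ (Pi.single i c),
    ← lintegral_const_mul _ ((measurable_prod_expDensity m).indicator hA')]
  refine lintegral_congr fun e => ?_
  have hprod : ∀ e : Fin m → ℝ, ∏ j, expDensity (e j) =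
      expDensity (e i) * ∏ j ∈ Finset.univ.erase i, expDensity (e j) := fun e =>
    (Finset.mul_prod_erase _ _ (Finset.mem_univ i)).symm
  by_cases he : e + Pi.single i c ∈ A
  · rw [indicator_of_mem (show e ∈ {e : Fin m → ℝ | e + (Pi.single i c : Fin m → ℝ) ∈ A} from he)]
    by_cases h0 : 0 ≤ e i
    · rw [indicator_of_mem (show e + (Pi.single i c : Fin m → ℝ) ∈ {e : Fin m → ℝ | c ≤ e i} ∩ A from
        ⟨by simpa using h0, he⟩), hprod, hprod e, ← mul_assoc]
      congr 1
      · rw [expDensity, indicator_of_mem (show e i ∈ Ici (0 : ℝ) from h0), indicator_of_mem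
          (show (e + Pi.single i c : Fin m → ℝ) i ∈ Ici (0 : ℝ) by simp; positivity),
          ← ENNReal.ofReal_mul (Real.exp_pos _).le, ← Real.exp_add, Pi.add_apply,
          Pi.single_eq_same]
        ring_nf
      · refine Finset.prod_congr rfl fun j hj => ?_
        rw [Pi.add_apply, Pi.single_eq_of_ne (Finset.ne_of_mem_erase hj), add_zero]
    · rw [indicator_of_notMem fun h => h0 (by simpa using h.1), hprod e, expDensity,
        indicator_of_notMem (show e i ∉ Ici (0 : ℝ) from h0), zero_mul, mul_zero]
  · rw [indicator_of_notMem fun h => he h.2,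
      indicator_of_notMem (show e ∉ {e : Fin m → ℝ | e + (Pi.single i c : Fin m → ℝ) ∈ A} from he),
      mul_zero]

/-! ### Representation by independent exponential variables and positive dependence -/

section Dependence

variable {Ω : Type*} [MeasurableSpace Ω] {μ : Measure Ω} {P : ℕ → Ω → ℝ} {ν : Measure ℝ}

/-- The `P`-values as functions of the times `t_j = ψ⁻¹(F_j(P_j))`. -/
noncomputable def timeToP (μ : Measure Ω) (P : ℕ → Ω → ℝ) (ν : Measure ℝ) {m : ℕ}
    (idx : Fin m → ℕ) (t : Fin m → ℝ) (j : Fin m) : ℝ :=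
  quantile (μ.map (P (idx j))) (laplace ν (t j))

theorem ae_prod_expPi_pos (hν : ∀ᵐ z ∂ν, 0 < z) (m : ℕ) :
    ∀ᵐ q ∂(ν.prod (expPi m)), 0 < q.1 ∧ ∀ j, 0 < q.2 j :=
  (Measure.quasiMeasurePreserving_fst.ae hν).and
    (Measure.quasiMeasurePreserving_snd.ae (ae_expPi_pos m))

variable [IsProbabilityMeasure ν]

theorem measurable_timeToP {m : ℕ} (idx : Fin m → ℕ) : Measurable (timeToP μ P ν idx) :=
  measurable_pi_lambda _ fun j => (measurable_quantile _).comp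
    (measurable_laplace.comp (measurable_pi_apply j))

theorem timeToP_le_timeToP (hν : ∀ᵐ z ∂ν, 0 < z) {m : ℕ} (idx : Fin m → ℕ) {s t : Fin m → ℝ}
    (hs : ∀ j, 0 < s j) (hst : s ≤ t) : timeToP μ P ν idx t ≤ timeToP μ P ν idx s := fun j =>
  have ht : 0 < t j := (hs j).trans_le (hst j)
  quantile_monotoneOn _ (laplace_mem_Ioo hν ht) (laplace_mem_Ioo hν (hs j))
    ((laplace_strictAntiOn hν).antitoneOn (hs j).le ht.le (hst j))

theorem timeToP_le_iff (hν : ∀ᵐ z ∂ν, 0 < z) {m : ℕ} (idx : Fin m → ℕ) {t : Fin m → ℝ} {j : Fin m}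
    (ht : 0 < t j) {x : ℝ} (hx : 0 < cdf (μ.map (P (idx j))) x) :
    timeToP μ P ν idx t j ≤ x ↔
      generatorInv (laplace ν) (cdf (μ.map (P (idx j))) x) ≤ t j := by
  rw [timeToP, quantile_le_iff _ (laplace_mem_Ioo hν ht), generatorInv_le_iff hν hx ht.le]

theorem measurable_timeToP_div {m : ℕ} (idx : Fin m → ℕ) :
    Measurable fun q : ℝ × (Fin m → ℝ) => timeToP μ P ν idx fun j => q.2 j / q.1 :=
  (measurable_timeToP idx).comp (measurable_pi_lambda _ fun j =>
    ((measurable_pi_apply j).comp measurable_snd).div measurable_fst)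

/-- The probability that the `P`-values lie in `D` when `Z = z` and the `i`-th time exceeds `τ`. -/
noncomputable def condProb (μ : Measure Ω) (P : ℕ → Ω → ℝ) (ν : Measure ℝ) {m : ℕ}
    (idx : Fin m → ℕ) (D : Set (Fin m → ℝ)) (i : Fin m) (τ z : ℝ) : ℝ≥0∞ :=
  expPi m {e | timeToP μ P ν idx (fun j => e j / z + (Pi.single i τ : Fin m → ℝ) j) ∈ D}

theorem measurable_condProb {m : ℕ} (idx : Fin m → ℕ) {D : Set (Fin m → ℝ)} (hD : MeasurableSet D)
    (i : Fin m) (τ : ℝ) : Measurable (condProb μ P ν idx D i τ) := by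
  have h : Measurable fun q : ℝ × (Fin m → ℝ) =>
      timeToP μ P ν idx fun j => q.2 j / q.1 + (Pi.single i τ : Fin m → ℝ) j :=
    (measurable_timeToP idx).comp (measurable_pi_lambda _ fun j => by fun_prop)
  exact measurable_measure_prodMk_left (h hD)

/-- A larger `z` or a smaller `τ` shortens all times `e_j / z + τ 1_{j = i}`, which raises the
p-values and keeps them in the upper set. -/
theorem condProb_le_condProb (hν : ∀ᵐ z ∂ν, 0 < z) {m : ℕ} (idx : Fin m → ℕ) {D : Set (Fin m → ℝ)}
    (hD : IsUpperSet D) (i : Fin m) {τ τ' z z' : ℝ} (hτ' : 0 ≤ τ') (hτ : τ' ≤ τ) (hz : 0 < z)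
    (hz' : z ≤ z') : condProb μ P ν idx D i τ z ≤ condProb μ P ν idx D i τ' z' := by
  refine measure_mono_ae ((ae_expPi_pos m).mono fun e he hmem => ?_)
  have hs : ∀ j, 0 ≤ (Pi.single i τ' : Fin m → ℝ) j := fun j =>
    (Pi.single_nonneg (i := i).2 hτ' : (0 : Fin m → ℝ) ≤ Pi.single i τ') j
  have hle : ∀ j, (Pi.single i τ' : Fin m → ℝ) j ≤ (Pi.single i τ : Fin m → ℝ) j := fun j =>
    (Pi.single_le_single.2 hτ) j
  refine hD (timeToP_le_timeToP hν idx (fun j => ?_) fun j => ?_) hmem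
  · exact add_pos_of_pos_of_nonneg (div_pos (he j) (hz.trans_le hz')) (hs j)
  · exact add_le_add (div_le_div_of_nonneg_left (he j).le hz hz') (hle j)

variable [IsProbabilityMeasure μ]

/-- The frailty representation `T_j = E_j / Z`: by the two Galois connections, `P_j ≤ x_j` becomes
`Z c_j ≤ E_j` with `c_j = ψ⁻¹(F_j(x_j))`. Given `Z`, this has probability `∏ exp(-Z c_j)`. -/
theorem map_eq_map_timeToP (hmeas : ∀ i, Measurable (P i)) (hν : ∀ᵐ z ∂ν, 0 < z)
    (h : IsArchimedeanMixture μ (cdfTransform μ P) ν) {m : ℕ} {idx : Fin m → ℕ}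
    (hidx : Function.Injective idx) :
    μ.map (fun ω j => P (idx j) ω) =
      (ν.prod (expPi m)).map fun q => timeToP μ P ν idx fun j => q.2 j / q.1 := by
  have hPm : Measurable fun ω j => P (idx j) ω := measurable_pi_lambda _ fun j => hmeas _
  have := Measure.isProbabilityMeasure_map (μ := μ) hPm.aemeasurable
  refine Measure.pi_ext_of_Iic _ _ fun x => ?_
  rw [Measure.map_apply hPm measurableSet_Iic,
    Measure.map_apply (measurable_timeToP_div idx) measurableSet_Iic]
  change μ {ω | ∀ j, P (idx j) ω ≤ x j} = _
  by_cases hx : ∀ j, 0 < cdf (μ.map (P (idx j))) (x j)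
  · rw [measure_forall_le hmeas hν h hidx hx]
    set c : Fin m → ℝ := fun j => generatorInv (laplace ν) (cdf (μ.map (P (idx j))) (x j))
    have hset : ((fun q : ℝ × (Fin m → ℝ) => timeToP μ P ν idx fun j => q.2 j / q.1) ⁻¹' Iic x)
        =ᵐ[ν.prod (expPi m)] {q : ℝ × (Fin m → ℝ) | ∀ j, q.1 * c j ≤ q.2 j} := by
      filter_upwards [ae_prod_expPi_pos hν m] with q hq
      refine propext (forall_congr' fun j => ?_)
      rw [timeToP_le_iff hν idx (div_pos (hq.2 j) hq.1) (hx j), le_div_iff₀ hq.1, mul_comm]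
    have hms : MeasurableSet {q : ℝ × (Fin m → ℝ) | ∀ j, q.1 * c j ≤ q.2 j} := by
      rw [ofPred_forall]
      exact MeasurableSet.iInter fun j => measurableSet_le (by fun_prop) (by fun_prop)
    rw [measure_congr hset, Measure.prod_apply hms]
    refine lintegral_congr_ae (hν.mono fun z hz => ?_)
    exact (expPi_forall_le fun j => mul_nonneg hz.le (generatorInv_nonneg _ _)).symm
  · push Not at hx
    obtain ⟨j, hj⟩ := hx
    rw [measure_forall_le_eq_zero hmeas (le_antisymm hj (cdf_nonneg _ _))]
    refine (measure_eq_zero_iff_ae_notMem.2 ?_).symm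
    filter_upwards [ae_prod_expPi_pos hν m] with q hq hmem
    have hu := laplace_mem_Ioo hν (div_pos (hq.2 j) hq.1)
    exact (((quantile_le_iff _ hu).1 (hmem j)).trans hj).not_gt hu.1

/-- In the representation, `P_i ≤ s` reads `E_i ≥ zτ`. Lack of memory replaces this event by the
factor `exp(-zτ)` and the shift `E_i + zτ`, which is a shift of the time by `τ`. -/
theorem measure_mem_and_le_eq (hmeas : ∀ i, Measurable (P i)) (hν : ∀ᵐ z ∂ν, 0 < z)
    (h : IsArchimedeanMixture μ (cdfTransform μ P) ν) {m : ℕ} {idx : Fin m → ℕ}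
    (hidx : Function.Injective idx) {D : Set (Fin m → ℝ)} (hD : MeasurableSet D) (i : Fin m)
    {s : ℝ} (hs : 0 < cdf (μ.map (P (idx i))) s) :
    μ {ω | (fun j => P (idx j) ω) ∈ D ∧ P (idx i) ω ≤ s} =
      ∫⁻ z, ENNReal.ofReal
        (Real.exp (-(z * generatorInv (laplace ν) (cdf (μ.map (P (idx i))) s)))) *
        condProb μ P ν idx D i (generatorInv (laplace ν) (cdf (μ.map (P (idx i))) s)) z ∂ν := by
  set τ := generatorInv (laplace ν) (cdf (μ.map (P (idx i))) s)
  have hPm : Measurable fun ω j => P (idx j) ω := measurable_pi_lambda _ fun j => hmeas _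
  have hDs : MeasurableSet (D ∩ {x | x i ≤ s}) :=
    hD.inter (measurableSet_le (measurable_pi_apply i) measurable_const)
  have hmap := congrArg (fun ρ => ρ (D ∩ {x | x i ≤ s})) (map_eq_map_timeToP hmeas hν h hidx)
  simp only [Measure.map_apply hPm hDs, Measure.map_apply (measurable_timeToP_div idx) hDs] at hmap
  have hset : ((fun q : ℝ × (Fin m → ℝ) => timeToP μ P ν idx fun j => q.2 j / q.1) ⁻¹'
      (D ∩ {x | x i ≤ s})) =ᵐ[ν.prod (expPi m)] {q : ℝ × (Fin m → ℝ) |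
        q.1 * τ ≤ q.2 i ∧ (timeToP μ P ν idx fun j => q.2 j / q.1) ∈ D} := by
    filter_upwards [ae_prod_expPi_pos hν m] with q hq
    refine propext (and_comm.trans (and_congr_left fun _ => ?_))
    change timeToP μ P ν idx (fun j => q.2 j / q.1) i ≤ s ↔ _
    rw [timeToP_le_iff hν idx (div_pos (hq.2 i) hq.1) hs, le_div_iff₀ hq.1, mul_comm]
  have hms : MeasurableSet {q : ℝ × (Fin m → ℝ) |
        q.1 * τ ≤ q.2 i ∧ (timeToP μ P ν idx fun j => q.2 j / q.1) ∈ D} :=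
    (measurableSet_le (f := fun q : ℝ × (Fin m → ℝ) => q.1 * τ) (g := fun q => q.2 i)
      (by fun_prop) (by fun_prop)).inter (measurable_timeToP_div idx hD)
  refine hmap.trans ?_
  rw [measure_congr hset, Measure.prod_apply hms]
  refine lintegral_congr_ae (hν.mono fun z hz => ?_)
  have hA : MeasurableSet {e : Fin m → ℝ | (timeToP μ P ν idx fun j => e j / z) ∈ D} :=
    (measurable_timeToP_div idx).comp (measurable_prodMk_left (x := z)) hD
  refine (expPi_inter_le i (mul_nonneg hz.le (generatorInv_nonneg _ _)) hA).trans ?_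
  dsimp only
  congr 1
  refine congrArg _ (Set.ext fun e => ?_)
  have harg : (fun j => (e + Pi.single i (z * τ) : Fin m → ℝ) j / z) =
      fun j => e j / z + (Pi.single i τ : Fin m → ℝ) j := by
    funext j
    rcases eq_or_ne j i with rfl | hj
    · simp only [Pi.add_apply, Pi.single_eq_same]; field_simp
    · simp [Pi.single_eq_of_ne hj]
  simp only [mem_ofPred_eq, τ] at harg ⊢
  rw [harg]

/-- Positive regression dependence: for nondecreasing sets `D`, the conditional probability of `D`
given `P_i ≤ s` is nondecreasing in `s`. -/
theorem measure_mem_and_le_mul_le (hmeas : ∀ i, Measurable (P i)) (hν : ∀ᵐ z ∂ν, 0 < z)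
    (h : IsArchimedeanMixture μ (cdfTransform μ P) ν) {m : ℕ} {idx : Fin m → ℕ}
    (hidx : Function.Injective idx) {D : Set (Fin m → ℝ)} (hD : MeasurableSet D)
    (hup : IsUpperSet D) (i : Fin m) {s s' : ℝ} (hss : s ≤ s') :
    μ {ω | (fun j => P (idx j) ω) ∈ D ∧ P (idx i) ω ≤ s} * μ {ω | P (idx i) ω ≤ s'} ≤
      μ {ω | (fun j => P (idx j) ω) ∈ D ∧ P (idx i) ω ≤ s'} * μ {ω | P (idx i) ω ≤ s} := by
  rcases (cdf_nonneg (μ.map (P (idx i))) s).eq_or_lt with h0 | hs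
  · have : μ {ω | (fun j => P (idx j) ω) ∈ D ∧ P (idx i) ω ≤ s} = 0 := by
      refine measure_mono_null (fun ω hω => hω.2) (?_ : μ {ω | P (idx i) ω ≤ s} = 0)
      rw [← ofReal_cdf_map hmeas, ← h0, ENNReal.ofReal_zero]
    rw [this, zero_mul]
    exact zero_le
  have hs' : 0 < cdf (μ.map (P (idx i))) s' := hs.trans_le (monotone_cdf _ hss)
  rw [measure_mem_and_le_eq hmeas hν h hidx hD i hs, measure_mem_and_le_eq hmeas hν h hidx hD i hs']
  have hmarg : ∀ {x}, 0 < cdf (μ.map (P (idx i))) x → μ {ω | P (idx i) ω ≤ x} =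
      ∫⁻ z, ENNReal.ofReal
        (Real.exp (-(z * generatorInv (laplace ν) (cdf (μ.map (P (idx i))) x)))) ∂ν := by
    intro x hx
    rw [← ofReal_laplace hν (generatorInv_nonneg _ _), laplace_generatorInv hν ⟨hx, cdf_le_one _ _⟩,
      ofReal_cdf_map hmeas]
  rw [hmarg hs, hmarg hs']
  have hττ := generatorInv_antitoneOn hν hs hs' (monotone_cdf (μ.map (P (idx i))) hss)
  have hτ0 := generatorInv_nonneg (laplace ν) (cdf (μ.map (P (idx i))) s')
  set τ := generatorInv (laplace ν) (cdf (μ.map (P (idx i))) s)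
  set τ' := generatorInv (laplace ν) (cdf (μ.map (P (idx i))) s')
  set w : ℝ → ℝ≥0∞ := fun z => ENNReal.ofReal (Real.exp (-(z * τ)))
  have hw : Measurable w := by fun_prop
  have hΦ := measurable_condProb (μ := μ) (P := P) (ν := ν) idx hD i τ'
  have hg : Measurable fun z : ℝ => ENNReal.ofReal (Real.exp (z * (τ - τ'))) := by fun_prop
  have hΦg : Measurable fun z => condProb μ P ν idx D i τ' z *
      ENNReal.ofReal (Real.exp (z * (τ - τ'))) := hΦ.mul hg
  -- Under the tilt by `exp(-zτ)`, both the conditional probability of `D` and the likelihood ratio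
  -- `exp(z(τ - τ'))` increase in `z > 0`. The shift from `τ` to `τ'` inside the conditional
  -- probability is handled separately, by pointwise comparison.
  have key := lintegral_mul_lintegral_le_of_monotoneOn (μ := ν.withDensity w) (s := Ioi 0)
    ((withDensity_absolutelyContinuous ν w).ae_le hν) hΦ hg
    (fun z hz z' _ hzz => condProb_le_condProb hν idx hup i hτ0 le_rfl hz hzz)
    (fun z _ z' _ hzz => ENNReal.ofReal_le_ofReal (Real.exp_le_exp.2
      (mul_le_mul_of_nonneg_right hzz (sub_nonneg.2 hττ))))
  have hwg : ∀ z, w z * ENNReal.ofReal (Real.exp (z * (τ - τ'))) =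
      ENNReal.ofReal (Real.exp (-(z * τ'))) := fun z => by
    rw [← ENNReal.ofReal_mul (Real.exp_pos _).le, ← Real.exp_add]
    ring_nf
  rw [lintegral_withDensity_eq_lintegral_mul _ hw hΦ, lintegral_withDensity_eq_lintegral_mul _ hw hg,
    lintegral_withDensity_eq_lintegral_mul _ hw hΦg, withDensity_apply _ MeasurableSet.univ,
    Measure.restrict_univ] at key
  simp only [Pi.mul_apply, mul_left_comm (w _), hwg] at key
  calc _ ≤ (∫⁻ z, w z * condProb μ P ν idx D i τ' z ∂ν) *
        ∫⁻ z, ENNReal.ofReal (Real.exp (-(z * τ'))) ∂ν := by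
        refine mul_le_mul_left (lintegral_mono_ae (hν.mono fun z hz => ?_)) _
        exact mul_le_mul_right (condProb_le_condProb hν idx hup i hτ0 hττ hz le_rfl) _
    _ ≤ _ := key
    _ = _ := by
        rw [mul_comm]
        simp only [mul_comm (condProb _ _ _ _ _ _ _ _)]

end Dependence

/-! ### The linear step-up test -/

section LinearStepUp

variable {m : ℕ}

/-- Counting the coordinates below a level eliminates the sorting permutation; monotonicity and
measurability of the order statistics follow from this form. -/
theorem orderStat_le_iff (p : Fin m → ℝ) (j : Fin m) (a : ℝ) :
    orderStat p j ≤ a ↔ (j : ℕ) < (Finset.univ.filter fun i => p i ≤ a).card := by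
  have h := Tuple.lt_card_le_iff_apply_le_of_monotone (j := j) (a := a) (Tuple.monotone_sort p)
  rw [orderStat, ← Function.comp_apply (f := p), ← h]
  have hcard : (Finset.univ.filter fun i => (p ∘ Tuple.sort p) i ≤ a).card =
      (Finset.univ.filter fun i => p i ≤ a).card :=
    Finset.card_equiv (Tuple.sort p) fun i => by simp
  rw [hcard]

theorem orderStat_le_orderStat {p p' : Fin m → ℝ} (h : p ≤ p') (j : Fin m) :
    orderStat p j ≤ orderStat p' j := by
  rw [orderStat_le_iff]
  refine ((orderStat_le_iff p' j _).1 le_rfl).trans_le (Finset.card_le_card fun i hi => ?_)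
  rw [Finset.mem_filter] at hi ⊢
  exact ⟨hi.1, (h i).trans hi.2⟩

theorem lsuCount_antitone (q : ℝ) : Antitone (lsuCount (m := m) q) := fun _ _ h =>
  Finset.sup_mono fun j hj => by
    rw [Finset.mem_filter] at hj ⊢
    exact ⟨hj.1, (orderStat_le_orderStat h j).trans hj.2⟩

theorem lsuCount_le (q : ℝ) (p : Fin m → ℝ) : lsuCount q p ≤ m :=
  Finset.sup_le fun j _ => j.isLt

theorem numRejections_linearStepUp (q : ℝ) (p : Fin m → ℝ) :
    numRejections (linearStepUp m q) p = lsuCount q p := by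
  have h : numRejections (linearStepUp m q) p =
      (Finset.univ.filter fun j : Fin m => (j : ℕ) < lsuCount q p).card :=
    Finset.card_equiv (Tuple.sort p).symm fun i => by simp [linearStepUp]
  rw [h, Fin.card_filter_val_lt, min_eq_right (lsuCount_le q p)]

/-- The maximum defining `k` is attained, so `p_(k) ≤ kq/m`, and a rejected coordinate is at most
`p_(k)`. -/
theorem le_of_linearStepUp {q : ℝ} {p : Fin m → ℝ} {i : Fin m} (h : linearStepUp m q p i = true) :
    p i ≤ lsuCount q p * (q / m) := by
  have hlt : (((Tuple.sort p).symm i : Fin m) : ℕ) < lsuCount q p := of_decide_eq_true h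
  have hne : (Finset.univ.filter
      fun j : Fin m => orderStat p j ≤ ((j : ℝ) + 1) * q / m).Nonempty := by
    rw [Finset.nonempty_iff_ne_empty]
    intro h0
    rw [lsuCount, h0, Finset.sup_empty] at hlt
    exact Nat.not_lt_zero _ hlt
  obtain ⟨j, hj, hjk⟩ := Finset.exists_mem_eq_sup _ hne fun j : Fin m => (j : ℕ) + 1
  have hk : lsuCount q p = (j : ℕ) + 1 := hjk
  rw [hk] at hlt ⊢
  have hle : (Tuple.sort p).symm i ≤ j := Fin.le_def.2 (Nat.lt_succ_iff.1 hlt)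
  have h1 := Tuple.monotone_sort p hle
  rw [Function.comp_apply, Equiv.apply_symm_apply] at h1
  refine h1.trans ((Finset.mem_filter.1 hj).2.trans_eq ?_)
  push_cast
  ring

theorem measurable_orderStat (j : Fin m) : Measurable fun p : Fin m → ℝ => orderStat p j := by
  refine measurable_of_Iic fun a => ?_
  have : (fun p : Fin m → ℝ => orderStat p j) ⁻¹' Iic a =
      ⋃ s ∈ {s : Finset (Fin m) | (j : ℕ) < s.card}, ⋂ i ∈ s, {p | p i ≤ a} := by
    ext p
    simp only [mem_preimage, mem_Iic, orderStat_le_iff, mem_iUnion, mem_iInter, mem_ofPred_eq,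
      exists_prop]
    refine ⟨fun h => ⟨_, h, fun i hi => (Finset.mem_filter.1 hi).2⟩, fun ⟨s, hs, h⟩ =>
      hs.trans_le (Finset.card_le_card fun i hi => Finset.mem_filter.2 ⟨Finset.mem_univ i, h i hi⟩)⟩
  rw [this]
  exact MeasurableSet.biUnion (to_countable _) fun s _ =>
    Finset.measurableSet_biInter _ fun i _ =>
      measurableSet_le (measurable_pi_apply i) measurable_const

theorem measurable_lsuCount (q : ℝ) : Measurable (lsuCount (m := m) q) := by
  refine measurable_of_Iic fun r => ?_
  have : lsuCount (m := m) q ⁻¹' Iic r =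
      ⋂ j : Fin m, {p | ((j : ℝ) + 1) * q / m < orderStat p j} ∪ {_p | (j : ℕ) + 1 ≤ r} := by
    ext p
    simp only [mem_preimage, mem_Iic, lsuCount, Finset.sup_le_iff, Finset.mem_filter,
      Finset.mem_univ, true_and, mem_iInter, mem_union, mem_ofPred_eq]
    exact forall_congr' fun j => by rw [← not_le, imp_iff_not_or]
  rw [this]
  exact MeasurableSet.iInter fun j =>
    (measurableSet_lt measurable_const (measurable_orderStat j)).union (MeasurableSet.const _)

/-- The sorting permutation is characterized by finitely many comparisons, with ties broken by the
index. -/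
theorem measurableSet_sort_eq (σ : Equiv.Perm (Fin m)) :
    MeasurableSet {p : Fin m → ℝ | Tuple.sort p = σ} := by
  have : {p : Fin m → ℝ | Tuple.sort p = σ} =
      (⋂ i, ⋂ j, {p | p (σ i) ≤ p (σ j)} ∪ {_p | ¬ i ≤ j}) ∩
      ⋂ i, ⋂ j, {p | p (σ i) ≠ p (σ j)} ∪ {_p | i < j → σ i < σ j} := by
    ext p
    simp only [mem_ofPred_eq, mem_inter_iff, mem_iInter, mem_union]
    rw [eq_comm, Tuple.eq_sort_iff]
    refine and_congr (forall_congr' fun i => forall_congr' fun j => ?_)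
      (forall_congr' fun i => forall_congr' fun j => ?_)
    · rw [or_comm, ← imp_iff_not_or]; rfl
    · tauto
  rw [this]
  refine (MeasurableSet.iInter fun i => MeasurableSet.iInter fun j => ?_).inter
    (MeasurableSet.iInter fun i => MeasurableSet.iInter fun j => ?_)
  · exact (measurableSet_le (measurable_pi_apply (σ i)) (measurable_pi_apply (σ j))).union
      (MeasurableSet.const _)
  · exact (measurableSet_eq_fun (measurable_pi_apply (σ i)) (measurable_pi_apply (σ j))).compl.union
      (MeasurableSet.const _)

theorem measurable_linearStepUp (q : ℝ) : Measurable (linearStepUp m q) := by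
  refine measurable_pi_lambda _ fun i => measurable_to_bool ?_
  have : (fun p => linearStepUp m q p i) ⁻¹' {true} = ⋃ σ : Equiv.Perm (Fin m),
      {p | Tuple.sort p = σ} ∩ lsuCount q ⁻¹' Ioi ((σ.symm i : Fin m) : ℕ) := by
    ext p
    simp [linearStepUp]
  rw [this]
  exact MeasurableSet.iUnion fun σ =>
    (measurableSet_sort_eq σ).inter (measurable_lsuCount q measurableSet_Ioi)

-- Split by the value `k + 1` of `R`: a rejection of `i` then adds `1 / (k + 1)` and forces `p i ≤
-- (k + 1) q / m`. The bound replaces rejection by this threshold event, which no longer involves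
-- the rank of `i`.
open scoped Classical in
theorem falseRejectionProportion_le (q : ℝ) (I₀ : Set (Fin m)) (p : Fin m → ℝ) :
    (numFalseRejections I₀ (linearStepUp m q) p : ℝ) /
        (max (numRejections (linearStepUp m q) p) 1 : ℕ) ≤
      ∑ i ∈ Finset.univ.filter (· ∈ I₀), ∑ k ∈ Finset.range m,
        if lsuCount q p = k + 1 ∧ p i ≤ ((k + 1 : ℕ) : ℝ) * (q / m) then ((k : ℝ) + 1)⁻¹ else 0 := by
  rw [numRejections_linearStepUp]
  have hnn : ∀ i k, 0 ≤ if lsuCount q p = k + 1 ∧ p i ≤ ((k + 1 : ℕ) : ℝ) * (q / m)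
      then ((k : ℝ) + 1)⁻¹ else 0 := fun i k => by split_ifs <;> positivity
  have hV : numFalseRejections I₀ (linearStepUp m q) p =
      ((Finset.univ.filter (· ∈ I₀)).filter fun i => linearStepUp m q p i = true).card := by
    rw [numFalseRejections, Finset.filter_filter]
  rw [hV, Finset.card_filter, Nat.cast_sum, Finset.sum_div]
  refine Finset.sum_le_sum fun i _ => ?_
  by_cases hrej : linearStepUp m q p i = true
  · have hpos : 0 < lsuCount q p := (Nat.zero_le _).trans_lt (of_decide_eq_true hrej)
    obtain ⟨k, hk⟩ := Nat.exists_eq_succ_of_ne_zero hpos.ne'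
    have hle := le_of_linearStepUp hrej
    rw [if_pos hrej, max_eq_left hpos]
    refine le_trans (le_of_eq ?_) (Finset.single_le_sum (fun k _ => hnn i k)
      (Finset.mem_range.2 (hk.symm.trans_le (lsuCount_le q p) : k + 1 ≤ m)))
    rw [if_pos ⟨hk, by rw [hk] at hle; exact hle⟩, hk]
    push_cast
    rw [one_div]
  · rw [if_neg hrej, Nat.cast_zero, zero_div]
    exact Finset.sum_nonneg fun k _ => hnn i k

end LinearStepUp

/-! ### Control of the false discovery rate -/

/-- The telescoping estimate behind the control of the false discovery rate under positive
regression dependence. -/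
theorem sum_div_le_of_positive_dependence {a : ℕ → ℕ → ℝ} {b c : ℕ → ℝ} {α : ℝ} (hα : 0 ≤ α)
    (hb0 : ∀ k, 0 ≤ b k) (hbmono : ∀ k, b k ≤ b (k + 1)) (ha0 : ∀ r k, 0 ≤ a r k)
    (hab : ∀ r k, a r k ≤ b k) (hc0 : ∀ k, 0 ≤ c k)
    (hc : ∀ k, a (k + 1) (k + 1) = a k (k + 1) + c k)
    (hdep : ∀ k, a k k * b (k + 1) ≤ a k (k + 1) * b k) (n : ℕ)
    (hbα : ∀ k ≤ n, b k ≤ k * α) :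
    ∑ k ∈ Finset.range n, ((k : ℝ) + 1)⁻¹ * c k ≤ α * (a n n / b n) := by
  induction n with
  | zero => simpa using mul_nonneg hα (div_nonneg (ha0 0 0) (hb0 0))
  | succ n ih =>
    rw [Finset.sum_range_succ]
    have ih' := ih fun k hk => hbα k (hk.trans n.le_succ)
    have hbn := hbα (n + 1) le_rfl
    push_cast at hbn
    -- If `b (n + 1) = 0`, then `c n` and `b n` vanish too, and both quotients are `0` by the
    -- convention for division by zero.
    rcases (hb0 (n + 1)).eq_or_lt with h0 | hpos
    · have hcn : c n = 0 := by
        have h1 := hab (n + 1) (n + 1)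
        have h2 := ha0 n (n + 1)
        have h3 := hc n
        have h4 := hc0 n
        linarith
      have han : α * (a n n / b n) = 0 := by
        rw [le_antisymm (h0 ▸ hbmono n) (hb0 n), div_zero, mul_zero]
      rw [hcn, mul_zero, add_zero, ← h0, div_zero, mul_zero]
      linarith
    · have h1 : ((n : ℝ) + 1)⁻¹ * c n ≤ α * (c n / b (n + 1)) := by
        have hn : (0 : ℝ) < (n : ℝ) + 1 := by positivity
        have : ((n : ℝ) + 1)⁻¹ ≤ α / b (n + 1) := by
          rw [inv_eq_one_div, div_le_div_iff₀ hn hpos]; linarith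
        calc ((n : ℝ) + 1)⁻¹ * c n ≤ α / b (n + 1) * c n :=
              mul_le_mul_of_nonneg_right this (hc0 n)
          _ = α * (c n / b (n + 1)) := by ring
      -- Positive dependence enters here: the conditional probability increases with the threshold,
      -- so the induction bound can be moved to the denominator `b (n + 1)`.
      have h2 : a n n / b n ≤ a n (n + 1) / b (n + 1) := by
        rcases (hb0 n).eq_or_lt with h0 | hpos'
        · rw [← h0, div_zero]; exact div_nonneg (ha0 _ _) hpos.le
        · rw [div_le_div_iff₀ hpos' hpos]; exact hdep n
      have h3 := mul_le_mul_of_nonneg_left h2 hα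
      rw [hc n, add_div, mul_add]
      linarith

section FDR

variable {Ω : Type*} [MeasurableSpace Ω] {μ : Measure Ω} [IsProbabilityMeasure μ]
  {P : ℕ → Ω → ℝ} {ν : Measure ℝ} [IsProbabilityMeasure ν]

/-- The contribution of a single true null hypothesis to the false discovery rate. -/
theorem sum_measureReal_lsuCount_le (hmeas : ∀ i, Measurable (P i)) (hν : ∀ᵐ z ∂ν, 0 < z)
    (h : IsArchimedeanMixture μ (cdfTransform μ P) ν) {m : ℕ} {q : ℝ} (hq : q ∈ Ioo (0 : ℝ) 1)
    (i : Fin m) (hvalid : ∀ t ∈ Icc (0 : ℝ) 1, μ {ω | P i ω ≤ t} ≤ ENNReal.ofReal t) :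
    ∑ k ∈ Finset.range m, ((k : ℝ) + 1)⁻¹ *
      μ.real {ω | lsuCount q (fun j : Fin m => P j ω) = k + 1 ∧
        P i ω ≤ ((k + 1 : ℕ) : ℝ) * (q / m)} ≤ q / m := by
  set X : Ω → Fin m → ℝ := fun ω j => P j ω with hX
  have hXm : Measurable X := measurable_pi_lambda _ fun j => hmeas _
  have hR : Measurable fun ω => lsuCount q (X ω) := (measurable_lsuCount q).comp hXm
  have hα : 0 ≤ q / m := div_nonneg hq.1.le (Nat.cast_nonneg m)
  have hmono : ∀ k : ℕ, (k : ℝ) * (q / m) ≤ ((k + 1 : ℕ) : ℝ) * (q / m) := fun k =>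
    mul_le_mul_of_nonneg_right (by push_cast; linarith) hα
  have hPle : ∀ t, MeasurableSet {ω | P i ω ≤ t} := fun t =>
    measurableSet_le (hmeas i) measurable_const
  -- Here `a r k / b k` is the conditional probability of `R ≤ r` given `P_i ≤ kq/m`. Validity of
  -- `P_i` is used only for `b k ≤ kq/m`, and the final ratio `a m m / b m` is at most `1`.
  refine (sum_div_le_of_positive_dependence (α := q / m)
    (a := fun r k => μ.real {ω | lsuCount q (X ω) ≤ r ∧ P i ω ≤ (k : ℝ) * (q / m)})
    (b := fun k => μ.real {ω | P i ω ≤ (k : ℝ) * (q / m)})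
    (c := fun k => μ.real {ω | lsuCount q (X ω) = k + 1 ∧ P i ω ≤ ((k + 1 : ℕ) : ℝ) * (q / m)})
    hα (fun _ => measureReal_nonneg) (fun k => measureReal_mono fun ω hω => hω.trans (hmono k))
    (fun _ _ => measureReal_nonneg)
    (fun r k => measureReal_mono fun ω hω => hω.2) (fun _ => measureReal_nonneg) ?_ ?_ m ?_).trans ?_
  · intro k
    rw [← measureReal_union]
    · congr 1
      ext ω
      simp only [mem_ofPred_eq, mem_union]
      rw [← or_and_right, Nat.le_succ_iff]
    · exact Set.disjoint_left.2 fun ω h1 h2 => by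
        have h1' : lsuCount q (X ω) ≤ k := h1.1
        have h2' : lsuCount q (X ω) = k + 1 := h2.1
        omega
    · exact (hR (measurableSet_singleton (k + 1))).inter (hPle _)
  · intro k
    have hdep := measure_mem_and_le_mul_le hmeas hν h (idx := fun j : Fin m => (j : ℕ))
      Fin.val_injective (D := lsuCount q ⁻¹' Iic k) (measurable_lsuCount q measurableSet_Iic)
      -- Larger p-values give fewer rejections, so `{R ≤ k}` is an upper set.
      (fun x y hxy hx => (lsuCount_antitone q hxy).trans hx) i
      (s := (k : ℝ) * (q / m)) (s' := ((k + 1 : ℕ) : ℝ) * (q / m))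
      (hmono k)
    simp only [measureReal_def, ← ENNReal.toReal_mul]
    exact ENNReal.toReal_mono (ENNReal.mul_ne_top (measure_ne_top _ _) (measure_ne_top _ _)) hdep
  · intro k hk
    have hm0 : (0 : ℝ) ≤ k * (q / m) := by positivity
    refine ENNReal.toReal_le_of_le_ofReal hm0 (hvalid _ ⟨hm0, ?_⟩)
    have hk' : (k : ℝ) ≤ m := by exact_mod_cast hk
    have hm : (0 : ℝ) < m := by exact_mod_cast (Nat.zero_le _).trans_lt i.isLt
    calc (k : ℝ) * (q / m) ≤ m * (q / m) := mul_le_mul_of_nonneg_right hk' hα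
      _ = q := mul_div_cancel₀ q hm.ne'
      _ ≤ 1 := hq.2.le
  · exact mul_le_of_le_one_right hα (div_le_one_of_le₀ (measureReal_mono fun ω hω => hω.2)
      measureReal_nonneg)

theorem falseDiscoveryRate_linearStepUp_le (hmeas : ∀ i, Measurable (P i))
    (hν : ∀ᵐ z ∂ν, 0 < z) (h : IsArchimedeanMixture μ (cdfTransform μ P) ν) {m : ℕ} {q : ℝ}
    (hq : q ∈ Ioo (0 : ℝ) 1) (I₀ : Set (Fin m))
    (hvalid : ∀ i ∈ I₀, ∀ t ∈ Icc (0 : ℝ) 1, μ {ω | P i ω ≤ t} ≤ ENNReal.ofReal t) :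
    falseDiscoveryRate μ (fun ω (i : Fin m) => P i ω) I₀ (linearStepUp m q) ≤ q := by
  classical
  set X : Ω → Fin m → ℝ := fun ω j => P j ω with hX
  have hXm : Measurable X := measurable_pi_lambda _ fun j => hmeas _
  have hR : Measurable fun ω => lsuCount q (X ω) := (measurable_lsuCount q).comp hXm
  have hE : ∀ (i : Fin m) (k : ℕ), MeasurableSet {ω | lsuCount q (X ω) = k + 1 ∧
      P i ω ≤ ((k + 1 : ℕ) : ℝ) * (q / m)} := fun i k =>
    (hR (measurableSet_singleton (k + 1))).inter (measurableSet_le (hmeas i) measurable_const)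
  have hite : ∀ (i : Fin m) (k : ℕ), (fun ω => if lsuCount q (X ω) = k + 1 ∧
      X ω i ≤ ((k + 1 : ℕ) : ℝ) * (q / m) then ((k : ℝ) + 1)⁻¹ else 0) =
      {ω | lsuCount q (X ω) = k + 1 ∧ P i ω ≤ ((k + 1 : ℕ) : ℝ) * (q / m)}.indicator
        fun _ => ((k : ℝ) + 1)⁻¹ := fun i k => by
    funext ω; simp only [indicator, mem_ofPred_eq, hX]
  have hint : ∀ (i : Fin m) (k : ℕ), Integrable (fun ω => if lsuCount q (X ω) = k + 1 ∧
      X ω i ≤ ((k + 1 : ℕ) : ℝ) * (q / m) then ((k : ℝ) + 1)⁻¹ else 0) μ := fun i k => by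
    rw [hite]; exact (integrable_const _).indicator (hE i k)
  calc falseDiscoveryRate μ X I₀ (linearStepUp m q)
      ≤ ∫ ω, ∑ i ∈ Finset.univ.filter (· ∈ I₀), ∑ k ∈ Finset.range m,
          (if lsuCount q (X ω) = k + 1 ∧ X ω i ≤ ((k + 1 : ℕ) : ℝ) * (q / m)
            then ((k : ℝ) + 1)⁻¹ else 0) ∂μ := by
        refine integral_mono_of_nonneg (Eventually.of_forall fun ω => by positivity)
          (integrable_finsetSum _ fun i _ => integrable_finsetSum _ fun k _ => hint i k)
          (Eventually.of_forall fun ω => ?_)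
        exact falseRejectionProportion_le q I₀ (X ω)
    _ = ∑ i ∈ Finset.univ.filter (· ∈ I₀), ∑ k ∈ Finset.range m, ((k : ℝ) + 1)⁻¹ *
          μ.real {ω | lsuCount q (X ω) = k + 1 ∧ P i ω ≤ ((k + 1 : ℕ) : ℝ) * (q / m)} := by
        rw [integral_finsetSum _ fun i _ => integrable_finsetSum _ fun k _ => hint i k]
        refine Finset.sum_congr rfl fun i _ => ?_
        rw [integral_finsetSum _ fun k _ => hint i k]
        refine Finset.sum_congr rfl fun k _ => ?_
        rw [hite, integral_indicator_const _ (hE i k), smul_eq_mul, mul_comm]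
    _ ≤ ∑ i ∈ Finset.univ.filter (· ∈ I₀), q / m := Finset.sum_le_sum fun i hi =>
        sum_measureReal_lsuCount_le hmeas hν h hq i (hvalid i (Finset.mem_filter.1 hi).2)
    _ ≤ ∑ _i : Fin m, q / m := Finset.sum_le_sum_of_subset_of_nonneg (Finset.filter_subset _ _)
        fun _ _ _ => div_nonneg hq.1.le (Nat.cast_nonneg m)
    _ ≤ q := by
        rw [Finset.sum_const, Finset.card_univ, Fintype.card_fin, nsmul_eq_mul]
        rcases m.eq_zero_or_pos with rfl | hm
        · simpa using hq.1.le
        · rw [mul_div_cancel₀ q (Nat.cast_ne_zero.2 hm.ne')]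

end FDR

theorem mainTheorem7 {Ω Θ Ξ : Type*} [MeasurableSpace Ω]
    -- the statistical model, the null hypotheses and the p-values
    (Pr : Θ → Ξ → Measure Ω) [∀ ϑ η, IsProbabilityMeasure (Pr ϑ η)]
    (H : ℕ → Set Θ) (P : ℕ → Ω → ℝ)
    (hmeas : ∀ i, Measurable (P i))
    (hrange : ∀ i ω, P i ω ∈ Icc (0 : ℝ) 1)
    -- validity under the null hypotheses (in particular, uniform distribution is allowed)
    (hvalid : ∀ ϑ η i, ϑ ∈ H i →
      ∀ t ∈ Icc (0 : ℝ) 1, Pr ϑ η {ω | P i ω ≤ t} ≤ ENNReal.ofReal t)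
    -- the p-values are absolutely continuous, and the `F_i(P_i)` are exchangeable
    (hac : ∀ ϑ η i, (Pr ϑ η).map (P i) ≪ volume)
    (hexch : ∀ ϑ η, Exchangeable (Pr ϑ η) (cdfTransform (Pr ϑ η) P))
    -- the law of the mixing variable `Z` and the conditional law of `F_i(P_i)` given `Z = z`
    (ν : Θ → Ξ → Measure ℝ) [∀ ϑ η, IsProbabilityMeasure (ν ϑ η)]
    (κ : Θ → Ξ → Kernel ℝ ℝ) [∀ ϑ η, IsMarkovKernel (κ ϑ η)]
    (hmix : ∀ ϑ η, IsMixture (Pr ϑ η) (cdfTransform (Pr ϑ η) P) (ν ϑ η) (κ ϑ η))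
    -- (i) `Z` is positive almost surely
    (hpos : ∀ ϑ η, ∀ᵐ z ∂(ν ϑ η), 0 < z)
    -- (ii) the conditional distribution functions are `exp(-z ψ⁻¹(p))`
    (hcond : ∀ ϑ η, ∀ᵐ z ∂(ν ϑ η), ∀ p ∈ Ioc (0 : ℝ) 1,
      κ ϑ η z (Iic p) =
        ENNReal.ofReal (Real.exp (-(z * generatorInv (laplace (ν ϑ η)) p)))) :
    -- (a)
    (∀ ϑ η, ∀ m : ℕ, 2 ≤ m → ∀ idx : Fin m → ℕ, Function.Injective idx →
      IsMTP2 ((Pr ϑ η).map (fun ω (j : Fin m) => P (idx j) ω))) ∧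
    -- (b)
    (∀ m : ℕ, ∀ q ∈ Ioo (0 : ℝ) 1, ControlsFDR Pr H P (linearStepUp m q) q) := by
  have hmix' : ∀ ϑ η, IsArchimedeanMixture (Pr ϑ η) (cdfTransform (Pr ϑ η) P) (ν ϑ η) := fun ϑ η =>
    (hmix ϑ η).isArchimedeanMixture (fun i ω => (cdfTransform_mem_Icc i ω).2) (hpos ϑ η) (hcond ϑ η)
  refine ⟨fun ϑ η m hm idx hidx => ?_, fun m q hq => ⟨measurable_linearStepUp q, fun ϑ η => ?_⟩⟩
  · exact isMTP2_map hmeas (hac ϑ η) (hpos ϑ η) (hmix' ϑ η) (by omega) hidx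
  · exact falseDiscoveryRate_linearStepUp_le hmeas (hpos ϑ η) (hmix' ϑ η) hq _
      fun i hi => hvalid ϑ η i hi
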